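/- Consider the family of complex quadratic systems $$\dot x = x - a_{10}x^2 - a_{01}xy - a_{-12}y^2,\qquad \dot y = -(y - b_{10}xy - b_{01}y^2 - b_{2,-1}x^2),$$ with parameters $(a_{10},a_{01},a_{-12},b_{2,-1},b_{10},b_{01})\in\mathbb{C}^6$, and write $P,Q$ for the right-hand sides of the two equations and $R=\mathbb{C}[a_{10},a_{01},a_{-12},b_{2,-1},b_{10},b_{01}]$. A sequence of focus quantities of the family is a sequence $g_{11},g_{22},g_{33},\dots\in R$ for which there is a formal power series $\Psi(x,y)=xy+\sum_{s\ge 3}\sum_{j=0}^{s}v_{j,s-j}x^jy^{s-j}$ with $v_{j,s-j}\in R$ such that $$\frac{\partial\Psi}{\partial x}P+\frac{\partial\Psi}{\partial y}Q=g_{11}(xy)^2+g_{22}(xy)^3+g_{33}(xy)^4+\cdots .$$ The center variety of the family is $\mathbf V(\langle g_{11},g_{22},g_{33},\dots\rangle)\subset\mathbb{C}^6$, where $\mathbf V(I)$ denotes the set of common zeros in $\mathbb{C}^6$ of an ideal $I\subset R$. Define the ideals of $R$ - $J_1^{(q)}=\langle 2a_{10}-b_{10},\ 2b_{01}-a_{01}\rangle$,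 - $J_2^{(q)}=\langle a_{01},\ b_{10}\rangle$, - $J_3^{(q)}=\langle 2a_{01}+b_{01},\ a_{10}+2b_{10},\ a_{01}b_{10}-a_{-12}b_{2,-1}\rangle$, - $J_4^{(q)}=\langle f_1,f_2,f_3,f_4,f_5\rangle$, where $f_1=a_{01}^3b_{2,-1}-a_{-12}b_{10}^3$, $f_2=a_{10}a_{01}-b_{01}b_{10}$, $f_3=a_{10}^3a_{-12}-b_{2,-1}b_{01}^3$, $f_4=a_{10}a_{-12}b_{10}^2-a_{01}^2b_{2,-1}b_{01}$, $f_5=a_{10}^2a_{-12}b_{10}-a_{01}b_{2,-1}b_{01}^2$. Then a sequence of focus quantities exists, and, for every choice of such a sequence, the center variety equals $\mathbf V(J_1^{(q)})\cup\mathbf V(J_2^{(q)})\cup\mathbf V(J_3^{(q)})\cup\mathbf V(J_4^{(q)})$ and its irreducible components (its maximal irreducible subvarieties) are exactly the four sets $\mathbf V(J_1^{(q)})$, $\mathbf V(J_2^{(q)})$, $\mathbf V(J_3^{(q)})$, $\mathbf V(J_4^{(q)})$, which are pairwise distinct. The ideals $J_1^{(q)},\dots,J_4^{(q)}$ are prime.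 Moreover, $\mathbf V(\langle f_1,f_2\rangle)=\mathbf V(J_4^{(q)})\cup\mathbf V(J_2^{(q)})$. -/

import Mathlib

namespace CenterVariety

noncomputable section

open MvPolynomial

section FocusQuantities

variable {σ : Type*}

/-- Consider a family of planar systems `x' = P(x, y)`, `y' = Q(x, y)` whose coefficients are
complex polynomials in parameters indexed by `σ` (variable `0` is `x`, variable `1` is `y`).
The sequence `g` (used for indices `k ≥ 1` only) is a sequence of focus quantities of the family
if there is a formal power series `Ψ = x y + (terms of degree at least 3)`, with coefficients
polynomial in the parameters, such that
`Ψ_x * P + Ψ_y * Q = g 1 * (x y)^2 + g 2 * (x y)^3 + g 3 * (x y)^4 + ...`. -/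
def IsFocusQuantities (P Q : MvPolynomial (Fin 2) (MvPolynomial σ ℂ))
    (g : ℕ → MvPolynomial σ ℂ) : Prop :=
  ∃ Ψ : MvPowerSeries (Fin 2) (MvPolynomial σ ℂ),
    (∀ n : Fin 2 →₀ ℕ, n 0 + n 1 ≤ 2 →
      MvPowerSeries.coeff n Ψ = if n 0 = 1 ∧ n 1 = 1 then 1 else 0) ∧
    (∀ n : Fin 2 →₀ ℕ,
      MvPowerSeries.coeff n
        (MvPowerSeries.pderiv (MvPolynomial σ ℂ) 0 Ψ *
            (P : MvPowerSeries (Fin 2) (MvPolynomial σ ℂ)) +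
          MvPowerSeries.pderiv (MvPolynomial σ ℂ) 1 Ψ *
            (Q : MvPowerSeries (Fin 2) (MvPolynomial σ ℂ))) =
        if n 0 = n 1 ∧ 2 ≤ n 0 then g (n 0 - 1) else 0)

/-- The ideal `⟨g 1, g 2, g 3, ...⟩` in the ring of polynomials in the parameters. -/
def focusIdeal (g : ℕ → MvPolynomial σ ℂ) : Ideal (MvPolynomial σ ℂ) :=
  Ideal.span {p | ∃ k : ℕ, 1 ≤ k ∧ p = g k}

/-- The center variety: the common zero set, in the complex parameter space, of the ideal
generated by the focus quantities `g 1, g 2, g 3, ...`. -/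
def centerVariety (g : ℕ → MvPolynomial σ ℂ) : Set (σ → ℂ) :=
  zeroLocus ℂ (focusIdeal g)

end FocusQuantities

section Varieties

variable {σ : Type*}

/-- Affine varieties (Zariski closed sets) in complex affine space. -/
def IsAffineVariety (W : Set (σ → ℂ)) : Prop :=
  ∃ I : Ideal (MvPolynomial σ ℂ), W = zeroLocus ℂ I

/-- Irreducible affine varieties: nonempty, and not the union of two proper subvarieties. -/
def IsIrreducibleVariety (W : Set (σ → ℂ)) : Prop :=
  IsAffineVariety W ∧ W.Nonempty ∧
    ∀ A B : Set (σ → ℂ), IsAffineVariety A → IsAffineVariety B → W = A ∪ B → W = A ∨ W = B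

/-- The irreducible components of `V`: the irreducible varieties contained in `V` that are
maximal with respect to inclusion. -/
def irreducibleComponentsOf (V : Set (σ → ℂ)) : Set (Set (σ → ℂ)) :=
  {W | Maximal (fun U : Set (σ → ℂ) => IsIrreducibleVariety U ∧ U ⊆ V) W}

end Varieties

section Quadratic

/-- The ring `ℂ[a₁₀, a₀₁, a₋₁₂, b₂₋₁, b₁₀, b₀₁]`. -/
abbrev Param : Type := MvPolynomial (Fin 6) ℂ

/-- The coefficient `a₁₀`. -/
def a10 : Param := X 0
/-- The coefficient `a₀₁`. -/
def a01 : Param := X 1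
/-- The coefficient `a₋₁₂`. -/
def am12 : Param := X 2
/-- The coefficient `b₂₋₁`. -/
def b2m1 : Param := X 3
/-- The coefficient `b₁₀`. -/
def b10 : Param := X 4
/-- The coefficient `b₀₁`. -/
def b01 : Param := X 5

/-- The phase variable `x`. -/
def x : MvPolynomial (Fin 2) Param := X 0
/-- The phase variable `y`. -/
def y : MvPolynomial (Fin 2) Param := X 1

/-- The right-hand side of `x' = x - a₁₀ x² - a₀₁ x y - a₋₁₂ y²`. -/
def quadP : MvPolynomial (Fin 2) Param :=
  x - C a10 * x ^ 2 - C a01 * (x * y) - C am12 * y ^ 2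

/-- The right-hand side of `y' = -(y - b₁₀ x y - b₀₁ y² - b₂₋₁ x²)`. -/
def quadQ : MvPolynomial (Fin 2) Param :=
  -(y - C b10 * (x * y) - C b01 * y ^ 2 - C b2m1 * x ^ 2)

def f1 : Param := a01 ^ 3 * b2m1 - am12 * b10 ^ 3
def f2 : Param := a10 * a01 - b01 * b10
def f3 : Param := a10 ^ 3 * am12 - b2m1 * b01 ^ 3
def f4 : Param := a10 * am12 * b10 ^ 2 - a01 ^ 2 * b2m1 * b01
def f5 : Param := a10 ^ 2 * am12 * b10 - a01 * b2m1 * b01 ^ 2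

def J1 : Ideal Param := Ideal.span {2 * a10 - b10, 2 * b01 - a01}
def J2 : Ideal Param := Ideal.span {a01, b10}
def J3 : Ideal Param :=
  Ideal.span {2 * a01 + b01, a10 + 2 * b10, a01 * b10 - am12 * b2m1}
def J4 : Ideal Param := Ideal.span {f1, f2, f3, f4, f5}

/-- The four ideals `J1, J2, J3, J4`, as a family. -/
def J : Fin 4 → Ideal Param := ![J1, J2, J3, J4]

end Quadratic

end

end CenterVariety

/-! Along the vector field, the coefficient of `x^i y^j` in the derivative of a series is `(i - j)`
times its own coefficient plus terms from degree `i + j - 1` (`recur`). Off the diagonal this can be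
solved for the coefficient; on the diagonal an obstruction remains, and these obstructions are the
focus quantities. The recursion gives existence. Its uniqueness part, `eq_zero_of_recur`, lets every
later argument work for an arbitrary choice of the free diagonal coefficients.

Each of the four varieties has its own reason for being a center. On `J1` the field is Hamiltonian;
on `J2` it has an inverse integrating factor that is generically a product of three invariant lines;
on `J3` an invariant conic times an invariant cubic serves as such a factor; on `J4` the system is
time-reversible. An inverse integrating factor not vanishing at the origin yields a formal first
integral with nonzero `xy` term, which kills all focus quantities. Reversibility kills them directly
by antisymmetry.

For `J3` and `J4` the mechanism is available only on a monomial parametrization, which need not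
reach every point of the variety. The kernels of these parametrizations are computed exactly
(`quadricIdeal_eq_ker`, `J4_eq_ker`), so vanishing on the parametrization becomes membership in the
ideal. The same kernels show that the ideals are prime.

Conversely, three focus quantities suffice. The first is `f2` up to sign, so a center lies on
`V(J2)` or satisfies `a10 = s * b10`, `b01 = s * a01`. In the second case the next one is a multiple
of `f1 * (s + 2) * (2 * s - 1)`, and at `s = -2` the third is a multiple of `f1 * (a01 * b10 - am12
* b2m1)`. The factors lead to `J4`, `J3` and `J1`. The Nullstellensatz and four separating points
then identify the components. -/

namespace CenterVariety

noncomputable section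

open MvPolynomial

/-! ### Power series coefficients indexed by integers, and the action of the vector field on them.
-/

section Coefficients

variable {A : Type*} [CommRing A]

/-- The coefficient of `x ^ i * y ^ j`, extended by zero to all integers `i`, `j`. -/
def cf (F : MvPowerSeries (Fin 2) A) (i j : ℤ) : A :=
  if 0 ≤ i ∧ 0 ≤ j then
    MvPowerSeries.coeff (Finsupp.single 0 i.toNat + Finsupp.single 1 j.toNat) F
  else 0

lemma cf_of_neg {F : MvPowerSeries (Fin 2) A} {i j : ℤ} (h : i < 0 ∨ j < 0) : cf F i j = 0 :=
  if_neg (by omega)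

lemma finsupp_two (n : Fin 2 →₀ ℕ) :
    Finsupp.single 0 (n 0) + Finsupp.single 1 (n 1) = n := by
  ext k; fin_cases k <;> simp

lemma coeff_eq_cf (F : MvPowerSeries (Fin 2) A) (n : Fin 2 →₀ ℕ) :
    MvPowerSeries.coeff n F = cf F (n 0) (n 1) := by
  simp [cf, finsupp_two]

lemma cf_natCast (F : MvPowerSeries (Fin 2) A) (i j : ℕ) :
    cf F i j = MvPowerSeries.coeff (Finsupp.single 0 i + Finsupp.single 1 j) F := by
  simp [cf]

lemma ext_cf {F G : MvPowerSeries (Fin 2) A} (h : ∀ i j : ℕ, cf F i j = cf G i j) : F = G := by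
  ext n
  rw [coeff_eq_cf, coeff_eq_cf, h]

@[simp] lemma cf_add (F G : MvPowerSeries (Fin 2) A) (i j : ℤ) :
    cf (F + G) i j = cf F i j + cf G i j := by
  unfold cf; split_ifs <;> simp

@[simp] lemma cf_sub (F G : MvPowerSeries (Fin 2) A) (i j : ℤ) :
    cf (F - G) i j = cf F i j - cf G i j := by
  unfold cf; split_ifs <;> simp

@[simp] lemma cf_neg (F : MvPowerSeries (Fin 2) A) (i j : ℤ) :
    cf (-F) i j = -cf F i j := by
  unfold cf; split_ifs <;> simp

@[simp] lemma cf_zero (i j : ℤ) : cf (0 : MvPowerSeries (Fin 2) A) i j = 0 := by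
  unfold cf; split_ifs <;> simp

@[simp] lemma cf_C_mul (a : A) (F : MvPowerSeries (Fin 2) A) (i j : ℤ) :
    cf (MvPowerSeries.C a * F) i j = a * cf F i j := by
  unfold cf; split_ifs <;> simp

@[simp] lemma cf_X_zero_mul (F : MvPowerSeries (Fin 2) A) (i j : ℤ) :
    cf (MvPowerSeries.X 0 * F) i j = cf F (i - 1) j := by
  by_cases hj : 0 ≤ j
  swap
  · rw [cf_of_neg (by omega), cf_of_neg (by omega)]
  by_cases hi : 0 ≤ i
  swap
  · rw [cf_of_neg (by omega), cf_of_neg (by omega)]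
  lift i to ℕ using hi
  lift j to ℕ using hj
  rw [cf_natCast, MvPowerSeries.X, MvPowerSeries.coeff_monomial_mul]
  rcases i with _ | i
  · rw [if_neg, cf_of_neg (by omega)]
    intro h
    simpa using h 0
  · rw [if_pos, one_mul, coeff_eq_cf]
    · simp
    · intro k; fin_cases k <;> simp

@[simp] lemma cf_X_one_mul (F : MvPowerSeries (Fin 2) A) (i j : ℤ) :
    cf (MvPowerSeries.X 1 * F) i j = cf F i (j - 1) := by
  by_cases hj : 0 ≤ j
  swap
  · rw [cf_of_neg (by omega), cf_of_neg (by omega)]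
  by_cases hi : 0 ≤ i
  swap
  · rw [cf_of_neg (by omega), cf_of_neg (by omega)]
  lift i to ℕ using hi
  lift j to ℕ using hj
  rw [cf_natCast, MvPowerSeries.X, MvPowerSeries.coeff_monomial_mul]
  rcases j with _ | j
  · rw [if_neg, cf_of_neg (by omega)]
    intro h
    simpa using h 1
  · rw [if_pos, one_mul, coeff_eq_cf]
    · simp
    · intro k; fin_cases k <;> simp

@[simp] lemma cf_pderiv_zero (F : MvPowerSeries (Fin 2) A) (i j : ℤ) :
    cf (MvPowerSeries.pderiv A 0 F) i j = (i + 1 : ℤ) * cf F (i + 1) j := by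
  by_cases hj : 0 ≤ j
  swap
  · rw [cf_of_neg (by omega), cf_of_neg (by omega), mul_zero]
  by_cases hi : 0 ≤ i
  swap
  · rw [cf_of_neg (by omega)]
    -- At `i = -1` the shifted coefficient may be nonzero, but the factor `i + 1` vanishes; hence no
    -- boundary case is needed.
    by_cases h : i = -1
    · simp [h]
    · rw [cf_of_neg (by omega), mul_zero]
  lift i to ℕ using hi
  lift j to ℕ using hj
  rw [cf_natCast, MvPowerSeries.coeff_pderiv, coeff_eq_cf, mul_comm]
  simp

@[simp] lemma cf_pderiv_one (F : MvPowerSeries (Fin 2) A) (i j : ℤ) :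
    cf (MvPowerSeries.pderiv A 1 F) i j = (j + 1 : ℤ) * cf F i (j + 1) := by
  by_cases hi : 0 ≤ i
  swap
  · rw [cf_of_neg (by omega), cf_of_neg (by omega), mul_zero]
  by_cases hj : 0 ≤ j
  swap
  · rw [cf_of_neg (by omega)]
    by_cases h : j = -1
    · simp [h]
    · rw [cf_of_neg (by omega), mul_zero]
  lift i to ℕ using hi
  lift j to ℕ using hj
  rw [cf_natCast, MvPowerSeries.coeff_pderiv, coeff_eq_cf, mul_comm]
  simp

lemma cf_map {B : Type*} [CommRing B] (f : A →+* B) (F : MvPowerSeries (Fin 2) A) (i j : ℤ) :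
    cf (MvPowerSeries.map f F) i j = f (cf F i j) := by
  unfold cf; split_ifs <;> simp

/-- The first component of the quadratic vector field with coefficients
`α = (a₁₀, a₀₁, a₋₁₂, b₂₋₁, b₁₀, b₀₁)`. -/
def fieldP (α : Fin 6 → A) : MvPowerSeries (Fin 2) A :=
  MvPowerSeries.X 0 - MvPowerSeries.C (α 0) * (MvPowerSeries.X 0 * MvPowerSeries.X 0)
    - MvPowerSeries.C (α 1) * (MvPowerSeries.X 0 * MvPowerSeries.X 1)
    - MvPowerSeries.C (α 2) * (MvPowerSeries.X 1 * MvPowerSeries.X 1)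

/-- The second component of the quadratic vector field with coefficients
`α = (a₁₀, a₀₁, a₋₁₂, b₂₋₁, b₁₀, b₀₁)`. -/
def fieldQ (α : Fin 6 → A) : MvPowerSeries (Fin 2) A :=
  -(MvPowerSeries.X 1 - MvPowerSeries.C (α 4) * (MvPowerSeries.X 0 * MvPowerSeries.X 1)
    - MvPowerSeries.C (α 5) * (MvPowerSeries.X 1 * MvPowerSeries.X 1)
    - MvPowerSeries.C (α 3) * (MvPowerSeries.X 0 * MvPowerSeries.X 0))

/-- The derivative of a power series along the quadratic vector field. -/
def flow (α : Fin 6 → A) (F : MvPowerSeries (Fin 2) A) : MvPowerSeries (Fin 2) A :=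
  MvPowerSeries.pderiv A 0 F * fieldP α + MvPowerSeries.pderiv A 1 F * fieldQ α

/-- The action of `flow` on coefficients. -/
def recur (α : Fin 6 → A) (w : ℤ → ℤ → A) (i j : ℤ) : A :=
  (i - j : ℤ) * w i j + (j * α 4 - (i - 1 : ℤ) * α 0) * w (i - 1) j
    + ((j - 1 : ℤ) * α 5 - i * α 1) * w i (j - 1)
    - (i + 1 : ℤ) * α 2 * w (i + 1) (j - 2) + (j + 1 : ℤ) * α 3 * w (i - 2) (j + 1)

lemma cf_flow (α : Fin 6 → A) (F : MvPowerSeries (Fin 2) A) (i j : ℤ) :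
    cf (flow α F) i j = recur α (cf F) i j := by
  have h : flow α F =
      MvPowerSeries.X 0 * MvPowerSeries.pderiv A 0 F
      - MvPowerSeries.C (α 0) * (MvPowerSeries.X 0 * (MvPowerSeries.X 0
          * MvPowerSeries.pderiv A 0 F))
      - MvPowerSeries.C (α 1) * (MvPowerSeries.X 0 * (MvPowerSeries.X 1
          * MvPowerSeries.pderiv A 0 F))
      - MvPowerSeries.C (α 2) * (MvPowerSeries.X 1 * (MvPowerSeries.X 1
          * MvPowerSeries.pderiv A 0 F))
      - MvPowerSeries.X 1 * MvPowerSeries.pderiv A 1 F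
      + MvPowerSeries.C (α 4) * (MvPowerSeries.X 0 * (MvPowerSeries.X 1
          * MvPowerSeries.pderiv A 1 F))
      + MvPowerSeries.C (α 5) * (MvPowerSeries.X 1 * (MvPowerSeries.X 1
          * MvPowerSeries.pderiv A 1 F))
      + MvPowerSeries.C (α 3) * (MvPowerSeries.X 0 * (MvPowerSeries.X 0
          * MvPowerSeries.pderiv A 1 F)) := by
    unfold flow fieldP fieldQ
    ring
  rw [h]
  simp only [cf_add, cf_sub, cf_C_mul, cf_X_zero_mul, cf_X_one_mul, cf_pderiv_zero,
    cf_pderiv_one, recur]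
  have e1 : i - 1 + 1 = i := by ring
  have e3 : j - 1 - 1 = j - 2 := by ring
  have e4 : j - 1 + 1 = j := by ring
  have e6 : i - 1 - 1 = i - 2 := by ring
  have e7 : j - 2 + 1 = j - 1 := by ring
  have e8 : i - 2 + 1 = i - 1 := by ring
  simp only [e1, e3, e4, e6, e7, e8]
  push_cast
  ring

lemma flow_add (α : Fin 6 → A) (F G : MvPowerSeries (Fin 2) A) :
    flow α (F + G) = flow α F + flow α G := by
  simp only [flow, map_add]; ring

lemma flow_mul (α : Fin 6 → A) (F G : MvPowerSeries (Fin 2) A) :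
    flow α (F * G) = F * flow α G + G * flow α F := by
  simp only [flow, Derivation.leibniz, smul_eq_mul]; ring

lemma flow_C (α : Fin 6 → A) (a : A) : flow α (MvPowerSeries.C a) = 0 := by
  simp [flow]

lemma flow_C_mul (α : Fin 6 → A) (a : A) (F : MvPowerSeries (Fin 2) A) :
    flow α (MvPowerSeries.C a * F) = MvPowerSeries.C a * flow α F := by
  rw [flow_mul, flow_C, mul_zero, add_zero]

lemma flow_pow_eq_zero {α : Fin 6 → A} {F : MvPowerSeries (Fin 2) A} (h : flow α F = 0) (n : ℕ) :
    flow α (F ^ n) = 0 := by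
  induction n with
  | zero => rw [pow_zero, ← map_one MvPowerSeries.C, flow_C]
  | succ n ih => rw [pow_succ, flow_mul, h, ih, mul_zero, mul_zero, add_zero]

lemma coe_quadP : (quadP : MvPowerSeries (Fin 2) Param) = fieldP X := by
  simp only [← MvPolynomial.coeToMvPowerSeries.ringHom_apply, quadP, fieldP, map_sub, map_mul,
    map_pow]
  simp [x, y, a10, a01, am12, sq]

lemma coe_quadQ : (quadQ : MvPowerSeries (Fin 2) Param) = fieldQ X := by
  simp only [← MvPolynomial.coeToMvPowerSeries.ringHom_apply, quadQ, fieldQ, map_neg, map_sub,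
    map_mul, map_pow]
  simp [x, y, b10, b01, b2m1, sq]

end Coefficients

/-! ### Existence of focus quantities by solving the recursion degree by degree. -/

section Existence

lemma isFocusQuantities_quad_iff (g : ℕ → Param) :
    IsFocusQuantities quadP quadQ g ↔ ∃ Ψ : MvPowerSeries (Fin 2) Param,
      (∀ i j : ℕ, i + j ≤ 2 → cf Ψ i j = if i = 1 ∧ j = 1 then 1 else 0) ∧
      ∀ i j : ℕ, recur X (cf Ψ) i j = if i = j ∧ 2 ≤ i then g (i - 1) else 0 := by
  have key (Ψ : MvPowerSeries (Fin 2) Param) :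
      MvPowerSeries.pderiv Param 0 Ψ * (quadP : MvPowerSeries (Fin 2) Param) +
        MvPowerSeries.pderiv Param 1 Ψ * (quadQ : MvPowerSeries (Fin 2) Param) = flow X Ψ := by
    rw [coe_quadP, coe_quadQ, flow]
  unfold IsFocusQuantities
  refine exists_congr fun Ψ => ?_
  rw [key]
  refine and_congr ⟨fun h i j hij => ?_, fun h n hn => ?_⟩ ⟨fun h i j => ?_, fun h n => ?_⟩
  · rw [cf_natCast, h]
    · simp
    · simpa using hij
  · rw [coeff_eq_cf, h _ _ hn]
  · rw [← cf_flow, cf_natCast, h]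
    simp
  · rw [coeff_eq_cf, cf_flow, h]

/-- The contribution of the coefficients of degree `d` to the equation of degree `d + 1`. -/
def lowerTerms (d : ℕ) (w : ℤ → Param) (i : ℤ) : Param :=
  (((d + 1 - i : ℤ) : Param) * X 4 - ((i - 1 : ℤ) : Param) * X 0) * w (i - 1)
    + (((d - i : ℤ) : Param) * X 5 - (i : Param) * X 1) * w i
    - ((i + 1 : ℤ) : Param) * X 2 * w (i + 1) + ((d + 2 - i : ℤ) : Param) * X 3 * w (i - 2)

/-- The coefficients, by degree `d` and exponent `i` of `x`, of the solution with vanishing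
resonant coefficients. -/
def layer : ℕ → ℤ → Param
  | 0, _ => 0
  | d + 1, i =>
    if d = 1 ∧ i = 1 then 1
    else if 0 ≤ i ∧ i ≤ d + 1 then
      -- Here `2 * i - (d + 1)` is the difference of the two exponents. At resonance it is `0`,
      -- whose inverse is `0`, so the resonant coefficient is set to zero.
      C (-(2 * i - (d + 1) : ℂ)⁻¹) * lowerTerms d (layer d) i
    else 0

lemma layer_of_not_mem (d : ℕ) {i : ℤ} (h : i < 0 ∨ d < i) : layer d i = 0 := by
  cases d with
  | zero => rfl
  | succ d =>
    push_cast at h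
    rw [layer, if_neg (by omega), if_neg (by omega)]

/-- The power series with coefficients `layer`. -/
def formalSolution : MvPowerSeries (Fin 2) Param := fun n => layer (n 0 + n 1) (n 0)

lemma cf_formalSolution (d : ℕ) {i j : ℤ} (h : i + j = d) : cf formalSolution i j = layer d i := by
  by_cases hi : 0 ≤ i ∧ 0 ≤ j
  · obtain ⟨hi, hj⟩ := hi
    lift i to ℕ using hi
    lift j to ℕ using hj
    obtain rfl : d = i + j := by omega
    rw [cf_natCast, MvPowerSeries.coeff_apply]
    simp [formalSolution]
  · rw [cf_of_neg (by omega), layer_of_not_mem _ (by omega)]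

lemma recur_formalSolution (d : ℕ) {i j : ℤ} (h : i + j = d + 1) :
    recur X (cf formalSolution) i j =
      (i - j : ℤ) * layer (d + 1) i + lowerTerms d (layer d) i := by
  obtain rfl : j = d + 1 - i := by omega
  rw [recur, cf_formalSolution (d + 1) (by push_cast; ring), cf_formalSolution d (by ring),
    cf_formalSolution d (by ring), cf_formalSolution d (by ring), cf_formalSolution d (by ring),
    lowerTerms]
  push_cast
  ring

lemma layer_one (i : ℤ) : layer 1 i = 0 := by
  rw [layer, if_neg (by omega)]
  simp [lowerTerms, layer]

lemma layer_two (i : ℤ) : layer 2 i = if i = 1 then 1 else 0 := by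
  rw [layer]
  split_ifs with h1 h2 h3 h4 <;> simp_all [lowerTerms, layer_one]

/-- The quantity `g k` is taken to be whatever is left over at `(k + 1, k + 1)`, where the unknown
coefficient has factor zero and cannot absorb it. -/
theorem exists_focusQuantities : ∃ g : ℕ → Param, IsFocusQuantities quadP quadQ g := by
  refine ⟨fun k => recur X (cf formalSolution) (k + 1) (k + 1), ?_⟩
  rw [isFocusQuantities_quad_iff]
  refine ⟨formalSolution, fun i j hij => ?_, fun i j => ?_⟩
  · rw [cf_formalSolution (i + j) (by push_cast; ring)]
    have : i + j = 0 ∨ i + j = 1 ∨ i + j = 2 := by omega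
    rcases this with h | h | h
    · rw [h, layer, if_neg (by omega)]
    · rw [h, layer_one, if_neg (by omega)]
    · rw [h, layer_two]
      exact if_congr (by omega) rfl rfl
  · by_cases hd : i + j = 0
    · obtain ⟨rfl, rfl⟩ : i = 0 ∧ j = 0 := by omega
      simp [recur, cf_of_neg]
    obtain ⟨d, hd⟩ : ∃ d, i + j = d + 1 := ⟨i + j - 1, by omega⟩
    split_ifs with h
    · obtain ⟨rfl, h2⟩ := h
      have : ((i - 1 : ℕ) : ℤ) + 1 = i := by omega
      rw [this]
    · rw [recur_formalSolution d (by omega)]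
      by_cases hij : i = j
      · have : d = 1 := by omega
        subst this hij
        simp [lowerTerms, layer_one]
      · rw [layer, if_neg (by omega), if_pos (by omega)]
        have hne : (2 * (i : ℤ) - (d + 1) : ℂ) ≠ 0 := by
          have : (2 * (i : ℤ) - (d + 1) : ℤ) ≠ 0 := by omega
          exact_mod_cast this
        have hC : (((i : ℤ) - (j : ℤ) : ℤ) : Param) * C (-(2 * (i : ℤ) - (d + 1) : ℂ)⁻¹) = -1 := by
          have : (((i : ℤ) - (j : ℤ) : ℤ) : Param) = C (2 * (i : ℤ) - (d + 1) : ℂ) := by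
            have h1 : ((i : ℤ) - (j : ℤ) : ℤ) = 2 * (i : ℤ) - (d + 1) := by omega
            rw [h1]
            simp only [map_sub, map_mul, map_add, map_intCast, map_natCast, map_one, map_ofNat]
            push_cast
            ring
          rw [this, ← C_mul, mul_neg, mul_inv_cancel₀ hne]
          simp
        rw [← mul_assoc, hC]
        ring

end Existence

/-! ### Formal first integrals and inverse integrating factors force the focus quantities to vanish.
-/

section FirstIntegrals

/-- Off the diagonal the factor `i - j` is invertible, so each coefficient is determined by the
previous degree; induction on the degree leaves only the diagonal coefficients free. -/
lemma eq_zero_of_recur {α : Fin 6 → ℂ} {w : ℤ → ℤ → ℂ} {N : ℕ}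
    (hneg : ∀ i j, i < 0 ∨ j < 0 → w i j = 0) (hdiag : ∀ i : ℤ, 2 * i ≤ N → w i i = 0)
    (hrec : ∀ i j : ℤ, 0 ≤ i → 0 ≤ j → i ≠ j → i + j ≤ N → recur α w i j = 0) (i j : ℤ)
    (hij : i + j ≤ N) : w i j = 0 := by
  suffices h : ∀ d : ℕ, d ≤ N → ∀ i j : ℤ, i + j = d → w i j = 0 by
    by_cases h0 : i < 0 ∨ j < 0
    · exact hneg i j h0
    · exact h (i + j).toNat (by omega) i j (by omega)
  intro d
  induction d using Nat.strong_induction_on with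
  | _ d ih =>
    intro hd i j hij
    by_cases h0 : i < 0 ∨ j < 0
    · exact hneg i j h0
    by_cases hne : i = j
    · subst hne
      exact hdiag i (by omega)
    have low : ∀ i' j' : ℤ, i' + j' = d - 1 → w i' j' = 0 := fun i' j' h' => by
      by_cases hd0 : d = 0
      · exact hneg i' j' (by omega)
      · exact ih (d - 1) (by omega) (by omega) i' j' (by omega)
    have h := hrec i j (by omega) (by omega) hne (by omega)
    rw [recur, low (i - 1) j (by omega), low i (j - 1) (by omega), low (i + 1) (j - 2) (by omega),
      low (i - 2) (j + 1) (by omega)] at h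
    have hne' : ((i - j : ℤ) : ℂ) ≠ 0 := by exact_mod_cast sub_ne_zero.mpr hne
    simpa only [mul_zero, add_zero, sub_zero, mul_eq_zero, hne', false_or] using h

lemma recur_diag_eq_zero {α : Fin 6 → ℂ} {w : ℤ → ℤ → ℂ} {m : ℤ}
    (h : ∀ i j : ℤ, i + j < 2 * m → w i j = 0) : recur α w m m = 0 := by
  rw [recur, h (m - 1) _ (by omega), h m (m - 1) (by omega), h (m + 1) _ (by omega),
    h (m - 2) _ (by omega)]
  simp

/-- Evaluating the parameters turns the universal series into one over `ℂ`, where the recursion can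
be studied at a single system. -/
lemma exists_specialization {g : ℕ → Param} (hg : IsFocusQuantities quadP quadQ g)
    (α : Fin 6 → ℂ) : ∃ F : MvPowerSeries (Fin 2) ℂ,
      (∀ i j : ℕ, i + j ≤ 2 → cf F i j = if i = 1 ∧ j = 1 then 1 else 0) ∧
      ∀ i j : ℕ, recur α (cf F) i j = if i = j ∧ 2 ≤ i then aeval α (g (i - 1)) else 0 := by
  obtain ⟨Ψ, h1, h2⟩ := (isFocusQuantities_quad_iff g).mp hg
  refine ⟨MvPowerSeries.map (aeval α : Param →ₐ[ℂ] ℂ).toRingHom Ψ, fun i j hij => ?_,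
    fun i j => ?_⟩
  · rw [cf_map, h1 i j hij]
    split_ifs <;> simp
  · have h := congrArg (aeval α : Param →ₐ[ℂ] ℂ) (h2 i j)
    rw [apply_ite (aeval α : Param →ₐ[ℂ] ℂ), map_zero] at h
    rw [← h]
    simp only [recur, cf_map]
    simp

lemma order_X_mul_X :
    (2 : ℕ∞) ≤ (MvPowerSeries.X 0 * MvPowerSeries.X 1 : MvPowerSeries (Fin 2) ℂ).order := by
  refine le_trans ?_ MvPowerSeries.le_order_mul
  have h (i : Fin 2) : 1 ≤ (MvPowerSeries.X i : MvPowerSeries (Fin 2) ℂ).order := by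
    rw [MvPowerSeries.one_le_order_iff_constCoeff_eq_zero, MvPowerSeries.constantCoeff_X]
  exact le_trans (by norm_num) (add_le_add (h 0) (h 1))

/-- Powers of `Φ = xy + ...` have leading form `(xy)^k`, so they can be used to adjust diagonal
coefficients one at a time. -/
lemma order_pow_sub {Φ : MvPowerSeries (Fin 2) ℂ}
    (h : (3 : ℕ∞) ≤ (Φ - MvPowerSeries.X 0 * MvPowerSeries.X 1).order) (k : ℕ) :
    ((2 * k + 1 : ℕ) : ℕ∞) ≤
      (Φ ^ k - (MvPowerSeries.X 0 * MvPowerSeries.X 1) ^ k).order := by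
  have hz2 := order_X_mul_X
  set z : MvPowerSeries (Fin 2) ℂ := MvPowerSeries.X 0 * MvPowerSeries.X 1 with hz
  have hΦ2 : (2 : ℕ∞) ≤ Φ.order := by
    have : Φ = (Φ - z) + z := by ring
    rw [this]
    exact le_trans (le_min (le_trans (by norm_num) h) hz2) MvPowerSeries.min_order_le_add
  induction k with
  | zero => simp
  | succ k ih =>
    have hzk' : ((2 * k : ℕ) : ℕ∞) ≤ (z ^ k).order := by
      refine le_trans ?_ (MvPowerSeries.le_order_pow k)
      rw [nsmul_eq_mul]
      push_cast
      rw [mul_comm]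
      gcongr
    have e : Φ ^ (k + 1) - z ^ (k + 1) = (Φ ^ k - z ^ k) * Φ + z ^ k * (Φ - z) := by ring
    rw [e]
    refine le_trans (le_min ?_ ?_) MvPowerSeries.min_order_le_add
    · refine le_trans ?_ MvPowerSeries.le_order_mul
      refine le_trans (le_of_eq ?_) (add_le_add ih hΦ2)
      norm_cast
    · refine le_trans ?_ MvPowerSeries.le_order_mul
      refine le_trans (le_of_eq ?_) (add_le_add hzk' h)
      norm_cast

lemma cf_X_mul_X_pow (k : ℕ) (i j : ℤ) :
    cf ((MvPowerSeries.X 0 * MvPowerSeries.X 1 : MvPowerSeries (Fin 2) ℂ) ^ k) i j =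
      if i = k ∧ j = k then 1 else 0 := by
  induction k generalizing i j with
  | zero =>
    rw [pow_zero, cf]
    by_cases h : 0 ≤ i ∧ 0 ≤ j
    · obtain ⟨hi, hj⟩ := h
      lift i to ℕ using hi
      lift j to ℕ using hj
      classical
      rw [if_pos (by omega), MvPowerSeries.coeff_one]
      refine if_congr ?_ rfl rfl
      simp [DFunLike.ext_iff, Fin.forall_fin_two]
    · rw [if_neg h, if_neg (by omega)]
  | succ k ih =>
    rw [pow_succ', mul_assoc, cf_X_zero_mul, cf_X_one_mul, ih]
    refine if_congr ?_ rfl rfl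
    omega

lemma cf_pow_diag {Φ : MvPowerSeries (Fin 2) ℂ}
    (h : (3 : ℕ∞) ≤ (Φ - MvPowerSeries.X 0 * MvPowerSeries.X 1).order) {i k : ℕ} (hi : i ≤ k) :
    cf (Φ ^ k) i i = if i = k then 1 else 0 := by
  have e : Φ ^ k = (MvPowerSeries.X 0 * MvPowerSeries.X 1) ^ k +
      (Φ ^ k - (MvPowerSeries.X 0 * MvPowerSeries.X 1) ^ k) := by ring
  have h0 : cf (Φ ^ k - (MvPowerSeries.X 0 * MvPowerSeries.X 1) ^ k) (i : ℤ) i = 0 := by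
    rw [cf_natCast]
    apply MvPowerSeries.coeff_of_lt_order
    refine lt_of_lt_of_le ?_ (order_pow_sub h k)
    rw [map_add, Finsupp.degree_single, Finsupp.degree_single]
    exact_mod_cast (by omega : i + i < 2 * k + 1)
  rw [e, cf_add, h0, add_zero, cf_X_mul_X_pow]
  exact if_congr (by omega) rfl rfl

/-- Subtracting powers of a first integral removes the resonant coefficients. -/
lemma exists_flow_eq_zero_and_diag {α : Fin 6 → ℂ} {Φ : MvPowerSeries (Fin 2) ℂ}
    (h : (3 : ℕ∞) ≤ (Φ - MvPowerSeries.X 0 * MvPowerSeries.X 1).order) (hΦ : flow α Φ = 0)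
    (F : MvPowerSeries (Fin 2) ℂ) (m : ℕ) :
    ∃ H, flow α H = 0 ∧ ∀ i : ℕ, i < m → cf (F - H) i i = 0 := by
  induction m with
  | zero => exact ⟨0, by simp [flow], by simp⟩
  | succ m ih =>
    obtain ⟨H, h1, h2⟩ := ih
    -- The diagonal of `Φ ^ m` is zero before position `m` and `1` at `m`, so this correction leaves
    -- the earlier ones intact.
    refine ⟨H + MvPowerSeries.C (cf (F - H) m m) * Φ ^ m, ?_, fun i hi => ?_⟩
    · rw [flow_add, flow_C_mul, flow_pow_eq_zero hΦ, h1, mul_zero, add_zero]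
    · rw [← sub_sub, cf_sub, cf_C_mul, cf_pow_diag h (by omega)]
      split_ifs with him
      · rw [him, mul_one, sub_self]
      · rw [h2 i (by omega), mul_zero, sub_zero]

lemma flow_sub (α : Fin 6 → ℂ) (F G : MvPowerSeries (Fin 2) ℂ) :
    flow α (F - G) = flow α F - flow α G := by
  simp only [flow, map_sub]; ring

/-- Uniqueness in degree at most two applies to `Φ - xy`: the shifted terms of the recursion have
degree at most one there, so subtracting `xy` does not disturb the off-diagonal equations. -/
lemma order_sub_of_firstIntegral {α : Fin 6 → ℂ} {Φ : MvPowerSeries (Fin 2) ℂ}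
    (hΦ : flow α Φ = 0) (h0 : cf Φ 0 0 = 0) (h1 : cf Φ 1 1 = 1) :
    (3 : ℕ∞) ≤ (Φ - MvPowerSeries.X 0 * MvPowerSeries.X 1).order := by
  set w := cf (Φ - MvPowerSeries.X 0 * MvPowerSeries.X 1) with hw
  have hz (i j : ℤ) : cf (MvPowerSeries.X 0 * MvPowerSeries.X 1 : MvPowerSeries (Fin 2) ℂ) i j
      = if i = 1 ∧ j = 1 then 1 else 0 := by
    rw [← pow_one (MvPowerSeries.X 0 * MvPowerSeries.X 1), cf_X_mul_X_pow]
    simp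
  have hw' : ∀ i j, w i j = cf Φ i j - if i = 1 ∧ j = 1 then 1 else 0 := fun i j => by
    rw [hw, cf_sub, hz]
  have key := eq_zero_of_recur (α := α) (w := w) (N := 2) (fun i j hij => cf_of_neg hij)
    (fun i hi => ?_) (fun i j hi hj hne hij => ?_)
  · refine MvPowerSeries.le_order fun d hd => ?_
    rw [coeff_eq_cf, ← hw]
    refine key _ _ ?_
    have : d.degree < 3 := by exact_mod_cast hd
    rw [Finsupp.degree_eq_sum, Fin.sum_univ_two] at this
    push_cast
    omega
  · rw [hw']
    rcases lt_trichotomy i 0 with h | h | h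
    · rw [cf_of_neg (by omega), if_neg (by omega), sub_zero]
    · rw [h, h0]; simp
    · obtain rfl : i = 1 := by push_cast at hi; omega
      rw [h1]; simp
  · have hr : recur α (cf Φ) i j = 0 := by rw [← cf_flow, hΦ, cf_zero]
    have hd : recur α w i j = recur α (cf Φ) i j := by
      push_cast at hij
      simp only [recur, hw']
      rw [if_neg (by omega), if_neg (by omega), if_neg (by omega), if_neg (by omega),
        if_neg (by omega)]
      simp only [sub_zero]
    rw [hd, hr]

/-- The focus quantities vanish at a system having a formal first integral. -/
theorem aeval_eq_zero_of_firstIntegral {g : ℕ → Param} (hg : IsFocusQuantities quadP quadQ g)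
    {α : Fin 6 → ℂ} {Φ : MvPowerSeries (Fin 2) ℂ} (hΦ : flow α Φ = 0) (h0 : cf Φ 0 0 = 0)
    (h1 : cf Φ 1 1 ≠ 0) {k : ℕ} (hk : 1 ≤ k) : aeval α (g k) = 0 := by
  obtain ⟨F, -, hF⟩ := exists_specialization hg α
  have hΦ' : flow α (MvPowerSeries.C (cf Φ 1 1)⁻¹ * Φ) = 0 := by
    rw [flow_C_mul, hΦ, mul_zero]
  have hord := order_sub_of_firstIntegral hΦ' (by rw [cf_C_mul, h0, mul_zero])
    (by rw [cf_C_mul, inv_mul_cancel₀ h1])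
  obtain ⟨H, hH, hd⟩ := exists_flow_eq_zero_and_diag hord hΦ' F (k + 1)
  have hrec (i j : ℤ) : recur α (cf (F - H)) i j = recur α (cf F) i j := by
    rw [← cf_flow, flow_sub, hH, sub_zero, cf_flow]
  -- `F - H` obeys the off-diagonal equations of `F` and has no diagonal through `(k, k)`, so it
  -- vanishes through degree `2 * k + 1`. The equation at `(k + 1, k + 1)`, which sees only that
  -- degree, then gives `g k = 0` at `α`.
  have key := eq_zero_of_recur (α := α) (w := cf (F - H)) (N := 2 * k + 1)
    (fun i j hij => cf_of_neg hij) (fun i hi => ?_) (fun i j hi hj hne hij => ?_)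
  · have h2 := recur_diag_eq_zero (α := α) (m := k + 1) (fun i j hij => key i j (by omega))
    rw [hrec] at h2
    have h3 := hF (k + 1) (k + 1)
    rw [if_pos (by omega)] at h3
    push_cast at h3
    rw [← h2, h3]
  · by_cases hi0 : i < 0
    · exact cf_of_neg (by omega)
    · lift i to ℕ using by omega
      exact hd i (by omega)
  · lift i to ℕ using hi
    lift j to ℕ using hj
    rw [hrec, hF, if_neg (by omega)]

/-- The divergence of the quadratic vector field. -/
def divergence (α : Fin 6 → ℂ) : MvPowerSeries (Fin 2) ℂ :=
  MvPowerSeries.C (α 4 - 2 * α 0) * MvPowerSeries.X 0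
    + MvPowerSeries.C (2 * α 5 - α 1) * MvPowerSeries.X 1

lemma pderiv_field (α : Fin 6 → ℂ) :
    MvPowerSeries.pderiv ℂ 0 (fieldP α) + MvPowerSeries.pderiv ℂ 1 (fieldQ α) = divergence α := by
  simp only [fieldP, fieldQ, divergence, map_sub, map_neg, Derivation.leibniz,
    MvPowerSeries.pderiv_C, MvPowerSeries.pderiv_X_self, smul_eq_mul,
    MvPowerSeries.pderiv_X_of_ne (show (1 : Fin 2) ≠ 0 by decide),
    MvPowerSeries.pderiv_X_of_ne (show (0 : Fin 2) ≠ 1 by decide), map_mul, map_ofNat]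
  ring

/-- A closed formal one-form is exact. -/
lemma exists_potential {M N : MvPowerSeries (Fin 2) ℂ}
    (h : MvPowerSeries.pderiv ℂ 0 M + MvPowerSeries.pderiv ℂ 1 N = 0) :
    ∃ H, MvPowerSeries.pderiv ℂ 1 H = M ∧ MvPowerSeries.pderiv ℂ 0 H = -N ∧ cf H 0 0 = 0 := by
  -- Integrate `M` in `y` for all terms containing `y`, and `-N` in `x` for the pure powers of `x`.
  let H : MvPowerSeries (Fin 2) ℂ := fun n =>
    if n 1 = 0 then -cf N (n 0 - 1) 0 / n 0 else cf M (n 0) (n 1 - 1) / n 1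
  have hH (i j : ℕ) : cf H i j =
      if j = 0 then -cf N (i - 1) 0 / i else cf M i (j - 1) / j := by
    rw [cf_natCast, MvPowerSeries.coeff_apply]
    simp [H]
  refine ⟨H, ext_cf fun i j => ?_, ext_cf fun i j => ?_, ?_⟩
  · have h1 := hH i (j + 1)
    rw [if_neg (by omega)] at h1
    push_cast at h1
    rw [cf_pderiv_one, h1, add_sub_cancel_right]
    have : (j : ℂ) + 1 ≠ 0 := by exact_mod_cast j.succ_ne_zero
    push_cast
    field_simp
  · have h1 := hH (i + 1) j
    have hi : (i : ℂ) + 1 ≠ 0 := by exact_mod_cast i.succ_ne_zero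
    push_cast at h1
    rw [cf_pderiv_zero, h1, cf_neg]
    rcases j with _ | j
    · simp only [if_true, add_sub_cancel_right]
      push_cast
      field_simp
    · have h2 := congrArg (fun F => cf F (i : ℤ) (j : ℤ)) h
      simp only [cf_add, cf_pderiv_zero, cf_pderiv_one, cf_zero] at h2
      have hj : (j : ℂ) + 1 ≠ 0 := by exact_mod_cast j.succ_ne_zero
      rw [if_neg (by omega)]
      push_cast at h2 ⊢
      rw [add_sub_cancel_right]
      field_simp
      linear_combination h2
  · have := hH 0 0
    simpa using this

/-- The focus quantities vanish at a system having an invertible inverse integrating factor. -/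
theorem aeval_eq_zero_of_integratingFactor {g : ℕ → Param}
    (hg : IsFocusQuantities quadP quadQ g) {α : Fin 6 → ℂ} {V : MvPowerSeries (Fin 2) ℂ}
    (hV : flow α V = divergence α * V) (h0 : MvPowerSeries.constantCoeff V ≠ 0)
    {k : ℕ} (hk : 1 ≤ k) : aeval α (g k) = 0 := by
  have hinv : V⁻¹ * V = 1 := MvPowerSeries.inv_mul_cancel V h0
  have hflow : flow α V⁻¹ = -(divergence α * V⁻¹) := by
    have h1 : flow α (V⁻¹ * V) = 0 := by
      rw [hinv, ← map_one MvPowerSeries.C, flow_C]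
    rw [flow_mul, hV] at h1
    linear_combination V⁻¹ * h1 - (divergence α * V⁻¹ + flow α V⁻¹) * hinv
  -- Dividing the field by `V` makes it divergence-free, hence Hamiltonian; the Hamiltonian is the
  -- first integral sought.
  have hclosed : MvPowerSeries.pderiv ℂ 0 (V⁻¹ * fieldP α)
      + MvPowerSeries.pderiv ℂ 1 (V⁻¹ * fieldQ α) = 0 := by
    have h2 := pderiv_field α
    rw [flow] at hflow
    simp only [Derivation.leibniz, smul_eq_mul] at hflow ⊢
    linear_combination hflow + V⁻¹ * h2
  obtain ⟨H, hH1, hH0, hH⟩ := exists_potential hclosed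
  refine aeval_eq_zero_of_firstIntegral hg (Φ := H) ?_ hH ?_ hk
  · rw [flow, hH0, hH1]
    ring
  -- The `xy` coefficient of `H` is the `x` coefficient of `V⁻¹ * fieldP α`, which is the inverse of
  -- the constant term of `V`.
  · have h3 := congrArg (fun F => cf F 1 0) hH1
    have e : V⁻¹ * fieldP α = MvPowerSeries.X 0 * V⁻¹
        - MvPowerSeries.C (α 0) * (MvPowerSeries.X 0 * (MvPowerSeries.X 0 * V⁻¹))
        - MvPowerSeries.C (α 1) * (MvPowerSeries.X 0 * (MvPowerSeries.X 1 * V⁻¹))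
        - MvPowerSeries.C (α 2) * (MvPowerSeries.X 1 * (MvPowerSeries.X 1 * V⁻¹)) := by
      rw [fieldP]; ring
    simp only [e, cf_sub, cf_C_mul, cf_X_zero_mul, cf_X_one_mul, cf_pderiv_one] at h3
    rw [cf_of_neg (i := 1 - 1 - 1) (by omega), cf_of_neg (j := 0 - 1) (by omega),
      cf_of_neg (j := 0 - 1 - 1) (by omega)] at h3
    have h4 : cf V⁻¹ 0 0 = (MvPowerSeries.constantCoeff V)⁻¹ := by
      rw [← MvPowerSeries.constantCoeff_inv]
      simp [cf]
    simp only [sub_self, h4, mul_zero, sub_zero, zero_add, Int.cast_one, one_mul] at h3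
    rw [h3]
    exact inv_ne_zero h0

end FirstIntegrals

/-! ### Binomial ideals as kernels of monomial maps. -/

section ToricIdeals

variable {n : ℕ}

/-- The monomial map sending the `i`-th variable to the monomial with exponents `E i`. -/
def toricMap (E : Fin 6 → Fin n → ℕ) : Param →ₐ[ℂ] MvPolynomial (Fin n) ℂ :=
  aeval fun i => ∏ t, X t ^ E i t

lemma monomial_equivFunOnFinite {k : ℕ} (v : Fin k → ℕ) :
    monomial (Finsupp.equivFunOnFinite.symm v) (1 : ℂ) = ∏ i, X i ^ v i := by
  rw [monomial_eq, Finsupp.prod_fintype _ _ (by simp)]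
  simp

lemma toricMap_monomial (E : Fin 6 → Fin n → ℕ) (m : Fin 6 →₀ ℕ) (c : ℂ) :
    toricMap E (monomial m c) =
      monomial (Finsupp.equivFunOnFinite.symm fun t => ∑ i, m i * E i t) c := by
  rw [toricMap, aeval_monomial, Finsupp.prod_fintype _ _ (by simp), ← mul_one c, ← smul_eq_mul c 1,
    ← smul_monomial, monomial_equivFunOnFinite, smul_eq_mul, mul_one, algebraMap_eq, smul_eq_C_mul]
  congr 1
  simp_rw [← Finset.prod_pow, ← pow_mul]
  rw [Finset.prod_comm]
  refine Finset.prod_congr rfl fun t _ => ?_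
  rw [Finset.prod_pow_eq_pow_sum]
  simp_rw [mul_comm]

lemma aeval_toricMap (E : Fin 6 → Fin n → ℕ) (z : Fin n → ℂ) (f : Param) :
    aeval z (toricMap E f) = aeval (fun i => ∏ t, z t ^ E i t) f := by
  rw [toricMap, ← AlgHom.comp_apply, comp_aeval]
  simp

lemma sum_mul_eq_of_sub_mem {E : Fin 6 → Fin n → ℕ} {J : Ideal Param}
    (hJ : ∀ f ∈ J, toricMap E f = 0) {s t : Fin 6 →₀ ℕ}
    (h : monomial s (1 : ℂ) - monomial t 1 ∈ J) (k : Fin n) :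
    ∑ i, s i * E i k = ∑ i, t i * E i k := by
  have h1 := hJ _ h
  rw [map_sub, toricMap_monomial, toricMap_monomial, sub_eq_zero] at h1
  have h2 := monomial_left_injective (one_ne_zero (α := ℂ)) h1
  simpa using congrArg (fun v => v k) h2

/-- If any two distinct monomials with the same image can be brought closer by a binomial of `J`,
then differences of monomials with the same image lie in `J`. -/
lemma monomial_sub_mem {E : Fin 6 → Fin n → ℕ} {J : Ideal Param}
    (hJ : ∀ f ∈ J, toricMap E f = 0)
    (hmove : ∀ m m' : Fin 6 →₀ ℕ, (∀ k, ∑ i, m i * E i k = ∑ i, m' i * E i k) → m ≠ m' →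
      ∃ (s t : Fin 6 →₀ ℕ) (i : Fin 6), s ≤ m ∧ 0 < t i ∧ 0 < m' i ∧ s.degree = t.degree ∧
        monomial s (1 : ℂ) - monomial t 1 ∈ J) (d : ℕ) :
    ∀ m m' : Fin 6 →₀ ℕ, m.degree = d → (∀ k, ∑ i, m i * E i k = ∑ i, m' i * E i k) →
      monomial m (1 : ℂ) - monomial m' 1 ∈ J := by
  induction d with
  | zero =>
    intro m m' hm hw
    by_cases hne : m = m'
    · rw [hne, sub_self]; exact J.zero_mem
    obtain ⟨s, t, i, hs, hti, -, hst, -⟩ := hmove m m' hw hne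
    have h0 : m = 0 := (Finsupp.degree_eq_zero_iff m).mp hm
    have hs0 : s = 0 := le_antisymm (h0 ▸ hs) (zero_le)
    have ht0 : t = 0 := (Finsupp.degree_eq_zero_iff t).mp (by rw [← hst, hs0, map_zero])
    rw [ht0] at hti
    exact absurd hti (lt_irrefl 0)
  | succ d ih =>
    intro m m' hm hw
    by_cases hne : m = m'
    · rw [hne, sub_self]; exact J.zero_mem
    obtain ⟨s, t, i, hs, hti, hmi, hst, hJst⟩ := hmove m m' hw hne
    obtain ⟨k, rfl⟩ := exists_add_of_le hs
    obtain ⟨t', rfl⟩ := exists_add_of_le (show Finsupp.single i 1 ≤ t by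
      rw [Finsupp.single_le_iff]; exact hti)
    obtain ⟨n', rfl⟩ := exists_add_of_le (show Finsupp.single i 1 ≤ m' by
      rw [Finsupp.single_le_iff]; exact hmi)
    have hdeg : (t' + k).degree = d := by
      simp only [map_add, Finsupp.degree_single] at hm hst ⊢
      omega
    have h1 := ih (t' + k) n' hdeg fun l => by
      have h2 := hw l
      have h3 := sum_mul_eq_of_sub_mem hJ hJst l
      simp only [Finsupp.add_apply, add_mul, Finset.sum_add_distrib] at h2 h3 ⊢
      omega
    -- Replacing `s` by `t` in the first monomial creates a variable shared with the second;
    -- cancelling it lowers the degree.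
    have e : monomial (s + k) (1 : ℂ) - monomial (Finsupp.single i 1 + n') 1 =
        monomial k 1 * (monomial s 1 - monomial (Finsupp.single i 1 + t') 1)
          + monomial (Finsupp.single i 1) 1 * (monomial (t' + k) 1 - monomial n' 1) := by
      simp only [mul_sub, monomial_mul, one_mul]
      rw [add_comm s k, ← add_assoc (Finsupp.single i 1) t' k,
        add_comm k (Finsupp.single i 1 + t')]
      ring
    rw [e]
    exact J.add_mem (J.mul_mem_left _ hJst) (J.mul_mem_left _ h1)

/-- Monomials with equal image agree modulo `J`, so sending each image monomial to the class of any
preimage (and other monomials to zero) defines a linear map. Its composite with `toricMap E` is the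
quotient map, which therefore kills the kernel. -/
lemma mem_of_toricMap_eq_zero {E : Fin 6 → Fin n → ℕ} {J : Ideal Param}
    (hfib : ∀ m m' : Fin 6 →₀ ℕ, (∀ k, ∑ i, m i * E i k = ∑ i, m' i * E i k) →
      monomial m (1 : ℂ) - monomial m' 1 ∈ J) {f : Param} (hf : toricMap E f = 0) : f ∈ J := by
  classical
  let W (m : Fin 6 →₀ ℕ) : Fin n →₀ ℕ :=
    Finsupp.equivFunOnFinite.symm fun t => ∑ i, m i * E i t
  have hW (m m' : Fin 6 →₀ ℕ) (h : W m = W m') :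
      Ideal.Quotient.mkₐ ℂ J (monomial m 1) = Ideal.Quotient.mkₐ ℂ J (monomial m' 1) := by
    refine Ideal.Quotient.eq.mpr (hfib m m' fun k => ?_)
    simpa [W] using congrArg (fun v => v k) h
  let sec (v : Fin n →₀ ℕ) : Param ⧸ J :=
    if h : ∃ m, W m = v then Ideal.Quotient.mkₐ ℂ J (monomial h.choose 1) else 0
  have hsec (m : Fin 6 →₀ ℕ) : sec (W m) = Ideal.Quotient.mkₐ ℂ J (monomial m 1) := by
    have h : ∃ m', W m' = W m := ⟨m, rfl⟩
    simp only [sec, dif_pos h]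
    exact hW _ _ h.choose_spec
  let L : MvPolynomial (Fin n) ℂ →ₗ[ℂ] Param ⧸ J :=
    (MvPolynomial.basisMonomials (Fin n) ℂ).constr ℂ sec
  have hL : L ∘ₗ (toricMap E).toLinearMap = (Ideal.Quotient.mkₐ ℂ J).toLinearMap := by
    refine (MvPolynomial.basisMonomials (Fin 6) ℂ).ext fun m => ?_
    rw [LinearMap.comp_apply, AlgHom.toLinearMap_apply, AlgHom.toLinearMap_apply,
      coe_basisMonomials, toricMap_monomial, ← hsec]
    have := (MvPolynomial.basisMonomials (Fin n) ℂ).constr_basis ℂ sec (W m)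
    rwa [coe_basisMonomials] at this
  have h1 := LinearMap.congr_fun hL f
  rw [LinearMap.comp_apply, AlgHom.toLinearMap_apply, AlgHom.toLinearMap_apply, hf, map_zero] at h1
  exact Ideal.Quotient.eq_zero_iff_mem.mp h1.symm

/-- The kernel criterion for ideals generated by binomials. -/
lemma eq_ker_toricMap {E : Fin 6 → Fin n → ℕ} {J : Ideal Param}
    (hJ : ∀ f ∈ J, toricMap E f = 0)
    (hmove : ∀ m m' : Fin 6 →₀ ℕ, (∀ k, ∑ i, m i * E i k = ∑ i, m' i * E i k) → m ≠ m' →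
      ∃ (s t : Fin 6 →₀ ℕ) (i : Fin 6), s ≤ m ∧ 0 < t i ∧ 0 < m' i ∧ s.degree = t.degree ∧
        monomial s (1 : ℂ) - monomial t 1 ∈ J) :
    J = RingHom.ker (toricMap E) :=
  le_antisymm (fun f hf => hJ f hf) fun _ hf =>
    mem_of_toricMap_eq_zero (fun m m' h => monomial_sub_mem hJ hmove _ m m' rfl h) hf

lemma exists_move {J : Ideal Param} {m m' : Fin 6 →₀ ℕ} (s t : Fin 6 → ℕ) (i : Fin 6)
    (hs : ∀ k, s k ≤ m k) (ht : 0 < t i) (hm : 0 < m' i) (hd : ∑ k, s k = ∑ k, t k)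
    (hJ : (∏ k, X k ^ s k - ∏ k, X k ^ t k : Param) ∈ J) :
    ∃ (s t : Fin 6 →₀ ℕ) (i : Fin 6), s ≤ m ∧ 0 < t i ∧ 0 < m' i ∧ s.degree = t.degree ∧
        monomial s (1 : ℂ) - monomial t 1 ∈ J := by
  refine ⟨Finsupp.equivFunOnFinite.symm s, Finsupp.equivFunOnFinite.symm t, i, fun k => ?_, ?_, hm,
    ?_, ?_⟩
  · simpa using hs k
  · simpa using ht
  · simpa [Finsupp.degree_eq_sum] using hd
  · rwa [monomial_equivFunOnFinite, monomial_equivFunOnFinite]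

/-- The exponents of the parametrization of `J4`:
`a₁₀ = u p, a₀₁ = v q, a₋₁₂ = v³ r, b₂₋₁ = u³ r, b₁₀ = u q, b₀₁ = v p`. -/
def expJ4 : Fin 6 → Fin 5 → ℕ :=
  ![![1, 0, 1, 0, 0], ![0, 1, 0, 1, 0], ![0, 3, 0, 0, 1], ![3, 0, 0, 0, 1], ![1, 0, 0, 1, 0],
    ![0, 1, 1, 0, 0]]

lemma toricMap_X_expJ4 : (toricMap expJ4 a10 = X 0 * X 2 ∧ toricMap expJ4 a01 = X 1 * X 3 ∧
    toricMap expJ4 am12 = X 1 ^ 3 * X 4) ∧ (toricMap expJ4 b2m1 = X 0 ^ 3 * X 4 ∧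
    toricMap expJ4 b10 = X 0 * X 3 ∧ toricMap expJ4 b01 = X 1 * X 2) := by
  simp [toricMap, expJ4, a10, a01, am12, b2m1, b10, b01, Fin.prod_univ_five]

lemma toricMap_of_mem_J4 {f : Param} (hf : f ∈ J4) : toricMap expJ4 f = 0 := by
  rw [← RingHom.mem_ker]
  revert f
  change J4 ≤ _
  rw [J4, Ideal.span_le]
  obtain ⟨⟨h1, h2, h3⟩, h4, h5, h6⟩ := toricMap_X_expJ4
  rintro f (rfl | rfl | rfl | rfl | rfl) <;>
    simp only [SetLike.mem_coe, RingHom.mem_ker, f1, f2, f3, f4, f5, map_sub, map_mul, map_pow,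
      h1, h2, h3, h4, h5, h6] <;> ring

/-- The letters are the exponents of `a10, a01, am12, b2m1, b10, b01`. The first two cases are the
two directions of the move by `f2`. If neither applies, the exponents of `b2m1` must differ, and the
weights force a cubic factor to exchange for it or for `am12`. -/
lemma expJ4_cases {a b c d e f a' b' c' d' e' f' : ℕ} (w0 : a + d * 3 + e = a' + d' * 3 + e')
    (w1 : b + c * 3 + f = b' + c' * 3 + f') (w2 : a + f = a' + f') (w3 : b + e = b' + e')
    (hne : ¬ (a = a' ∧ b = b' ∧ c = c' ∧ d = d' ∧ e = e' ∧ f = f')) :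
    (1 ≤ a ∧ 1 ≤ b ∧ 1 ≤ f') ∨ (1 ≤ f ∧ 1 ≤ e ∧ 1 ≤ a') ∨ (1 ≤ d ∧ 1 ≤ c' ∧ 3 ≤ b + f) ∨
      (1 ≤ c ∧ 1 ≤ d' ∧ 3 ≤ a + e) := by
  by_cases h1 : a' < a ∧ e < e'
  · left; omega
  by_cases h2 : a < a' ∧ e' < e
  · right; left; omega
  rcases lt_trichotomy d d' with h | h | h
  · right; right; right; omega
  · exfalso; omega
  · right; right; left; omega

lemma J4_eq_ker : J4 = RingHom.ker (toricMap expJ4) := by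
  refine eq_ker_toricMap (fun f hf => toricMap_of_mem_J4 hf) fun m m' hw hne => ?_
  have g1 : f1 ∈ J4 := Ideal.subset_span (by simp)
  have g2 : f2 ∈ J4 := Ideal.subset_span (by simp)
  have g3 : f3 ∈ J4 := Ideal.subset_span (by simp)
  have g4 : f4 ∈ J4 := Ideal.subset_span (by simp)
  have g5 : f5 ∈ J4 := Ideal.subset_span (by simp)
  -- The fifth weight is redundant: `w0 + w1 - w2 - w3` is three times it.
  have w0 := hw 0
  have w1 := hw 1
  have w2 := hw 2
  have w3 := hw 3
  simp [expJ4, Fin.sum_univ_six] at w0 w1 w2 w3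
  have hne' : ¬ (m 0 = m' 0 ∧ m 1 = m' 1 ∧ m 2 = m' 2 ∧ m 3 = m' 3 ∧ m 4 = m' 4 ∧ m 5 = m' 5) := by
    rintro ⟨h0, h1, h2, h3, h4, h5⟩
    exact hne (Finsupp.ext fun k => by fin_cases k <;> assumption)
  clear hw hne
  rcases expJ4_cases w0 w1 w2 w3 hne' with h | h | ⟨h, h', h''⟩ | ⟨h, h', h''⟩
  · refine exists_move ![1, 1, 0, 0, 0, 0] ![0, 0, 0, 0, 1, 1] 5 (fun k => ?_) (by simp) h.2.2
      (by simp [Fin.sum_univ_six]) ?_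
    · fin_cases k <;> simp <;> omega
    · convert g2 using 1
      simp [Fin.prod_univ_six, f2, a10, a01, b10, b01]; ring
  · refine exists_move ![0, 0, 0, 0, 1, 1] ![1, 1, 0, 0, 0, 0] 0 (fun k => ?_) (by simp) h.2.2
      (by simp [Fin.sum_univ_six]) ?_
    · fin_cases k <;> simp <;> omega
    · convert J4.neg_mem g2 using 1
      simp [Fin.prod_univ_six, f2, a10, a01, b10, b01]; ring
  -- A cubic monomial in `a01, b01` divides the rest; its four types correspond to `f1`, `f4`, `f5`,
  -- `f3`.
  · have : 3 ≤ m 1 ∨ (2 ≤ m 1 ∧ 1 ≤ m 5) ∨ (1 ≤ m 1 ∧ 2 ≤ m 5) ∨ 3 ≤ m 5 := by omega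
    rcases this with h3 | h3 | h3 | h3
    · refine exists_move ![0, 3, 0, 1, 0, 0] ![0, 0, 1, 0, 3, 0] 2 (fun k => ?_) (by simp) h'
        (by simp [Fin.sum_univ_six]) ?_
      · fin_cases k <;> simp <;> omega
      · convert g1 using 1
        simp [Fin.prod_univ_six, f1, a01, am12, b2m1, b10]
    · refine exists_move ![0, 2, 0, 1, 0, 1] ![1, 0, 1, 0, 2, 0] 2 (fun k => ?_) (by simp) h'
        (by simp [Fin.sum_univ_six]) ?_
      · fin_cases k <;> simp <;> omega
      · convert J4.neg_mem g4 using 1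
        simp [Fin.prod_univ_six, f4, a10, a01, am12, b2m1, b10, b01]
    · refine exists_move ![0, 1, 0, 1, 0, 2] ![2, 0, 1, 0, 1, 0] 2 (fun k => ?_) (by simp) h'
        (by simp [Fin.sum_univ_six]) ?_
      · fin_cases k <;> simp <;> omega
      · convert J4.neg_mem g5 using 1
        simp [Fin.prod_univ_six, f5, a10, a01, am12, b2m1, b10, b01]
    · refine exists_move ![0, 0, 0, 1, 0, 3] ![3, 0, 1, 0, 0, 0] 2 (fun k => ?_) (by simp) h'
        (by simp [Fin.sum_univ_six]) ?_
      · fin_cases k <;> simp <;> omega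
      · convert J4.neg_mem g3 using 1
        simp [Fin.prod_univ_six, f3, a10, am12, b2m1, b01]
  · have : 3 ≤ m 4 ∨ (2 ≤ m 4 ∧ 1 ≤ m 0) ∨ (1 ≤ m 4 ∧ 2 ≤ m 0) ∨ 3 ≤ m 0 := by omega
    rcases this with h3 | h3 | h3 | h3
    · refine exists_move ![0, 0, 1, 0, 3, 0] ![0, 3, 0, 1, 0, 0] 3 (fun k => ?_) (by simp) h'
        (by simp [Fin.sum_univ_six]) ?_
      · fin_cases k <;> simp <;> omega
      · convert J4.neg_mem g1 using 1
        simp [Fin.prod_univ_six, f1, a01, am12, b2m1, b10]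
    · refine exists_move ![1, 0, 1, 0, 2, 0] ![0, 2, 0, 1, 0, 1] 3 (fun k => ?_) (by simp) h'
        (by simp [Fin.sum_univ_six]) ?_
      · fin_cases k <;> simp <;> omega
      · convert g4 using 1
        simp [Fin.prod_univ_six, f4, a10, a01, am12, b2m1, b10, b01]
    · refine exists_move ![2, 0, 1, 0, 1, 0] ![0, 1, 0, 1, 0, 2] 3 (fun k => ?_) (by simp) h'
        (by simp [Fin.sum_univ_six]) ?_
      · fin_cases k <;> simp <;> omega
      · convert g5 using 1
        simp [Fin.prod_univ_six, f5, a10, a01, am12, b2m1, b10, b01]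
    · refine exists_move ![3, 0, 1, 0, 0, 0] ![0, 0, 0, 1, 0, 3] 3 (fun k => ?_) (by simp) h'
        (by simp [Fin.sum_univ_six]) ?_
      · fin_cases k <;> simp <;> omega
      · convert g3 using 1
        simp [Fin.prod_univ_six, f3, a10, am12, b2m1, b01]

/-- The ideal of the quadric `a₀₁ b₁₀ = a₋₁₂ b₂₋₁`. -/
def quadricIdeal : Ideal Param := Ideal.span {a01 * b10 - am12 * b2m1}

/-- The exponents of the parametrization of the quadric `a₀₁ b₁₀ = a₋₁₂ b₂₋₁`:
`a₀₁ = r q p, a₋₁₂ = r² p, b₂₋₁ = q² s, b₁₀ = r q s`. -/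
def expQuadric : Fin 6 → Fin 6 → ℕ :=
  ![![0, 0, 0, 0, 1, 0], ![1, 1, 1, 0, 0, 0], ![2, 0, 1, 0, 0, 0], ![0, 2, 0, 1, 0, 0],
    ![1, 1, 0, 1, 0, 0], ![0, 0, 0, 0, 0, 1]]

lemma toricMap_of_mem_quadricIdeal {f : Param} (hf : f ∈ quadricIdeal) :
    toricMap expQuadric f = 0 := by
  rw [← RingHom.mem_ker]
  revert f
  change quadricIdeal ≤ _
  rw [quadricIdeal, Ideal.span_singleton_le_iff_mem, RingHom.mem_ker]
  simp [toricMap, expQuadric, a01, am12, b2m1, b10, Fin.prod_univ_six]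
  ring

lemma quadricIdeal_eq_ker : quadricIdeal = RingHom.ker (toricMap expQuadric) := by
  refine eq_ker_toricMap (fun f hf => toricMap_of_mem_quadricIdeal hf) fun m m' hw hne => ?_
  have g : a01 * b10 - am12 * b2m1 ∈ quadricIdeal := Ideal.subset_span (by simp)
  have w0 := hw 0
  have w1 := hw 1
  have w2 := hw 2
  have w3 := hw 3
  have w4 := hw 4
  have w5 := hw 5
  simp [expQuadric, Fin.sum_univ_six] at w0 w1 w2 w3 w4 w5
  have hne' : ¬ (m 0 = m' 0 ∧ m 1 = m' 1 ∧ m 2 = m' 2 ∧ m 3 = m' 3 ∧ m 4 = m' 4 ∧ m 5 = m' 5) := by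
    rintro ⟨h0, h1, h2, h3, h4, h5⟩
    exact hne (Finsupp.ext fun k => by fin_cases k <;> assumption)
  clear hw hne
  have hcases : (1 ≤ m 1 ∧ 1 ≤ m 4 ∧ 1 ≤ m' 2) ∨ (1 ≤ m 2 ∧ 1 ≤ m 3 ∧ 1 ≤ m' 1) := by omega
  rcases hcases with h | h
  · refine exists_move ![0, 1, 0, 0, 1, 0] ![0, 0, 1, 1, 0, 0] 2 (fun k => ?_) (by simp) h.2.2
      (by simp [Fin.sum_univ_six]) ?_
    · fin_cases k <;> simp <;> omega
    · convert g using 1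
      simp [Fin.prod_univ_six, a01, am12, b2m1, b10]
  · refine exists_move ![0, 0, 1, 1, 0, 0] ![0, 1, 0, 0, 1, 0] 1 (fun k => ?_) (by simp) h.2.2
      (by simp [Fin.sum_univ_six]) ?_
    · fin_cases k <;> simp <;> omega
    · convert quadricIdeal.neg_mem g using 1
      simp [Fin.prod_univ_six, a01, am12, b2m1, b10]

end ToricIdeals

/-! ### Primality: each ideal is the kernel of a map into a polynomial ring. -/

section PrimeIdeals

lemma sub_aeval_mem {J : Ideal Param} {v : Fin 6 → Param} (h : ∀ i, X i - v i ∈ J) (f : Param) :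
    f - aeval v f ∈ J := by
  have h1 : (Ideal.Quotient.mkₐ ℂ J).comp (aeval v) = Ideal.Quotient.mkₐ ℂ J := by
    refine MvPolynomial.algHom_ext fun i => ?_
    rw [AlgHom.comp_apply, aeval_X]
    exact (Ideal.Quotient.eq.mpr (h i)).symm
  exact Ideal.Quotient.eq.mp (AlgHom.congr_fun h1 f).symm

lemma isPrime_J1 : J1.IsPrime := by
  have h : J1 = RingHom.ker (aeval ![X 0, 2 * X 5, X 2, X 3, 2 * X 0, X 5] : Param →ₐ[ℂ] Param) := by
    apply le_antisymm
    · rw [J1, Ideal.span_le]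
      rintro f (rfl | rfl) <;>
        simp only [SetLike.mem_coe, RingHom.mem_ker, a10, a01, b10, b01, map_sub, map_mul,
          map_ofNat, aeval_X] <;> simp
    · intro f hf
      rw [RingHom.mem_ker] at hf
      have h1 : 2 * a10 - b10 ∈ J1 := Ideal.subset_span (by simp)
      have h2 : 2 * b01 - a01 ∈ J1 := Ideal.subset_span (by simp)
      have := sub_aeval_mem (J := J1) (v := ![X 0, 2 * X 5, X 2, X 3, 2 * X 0, X 5]) (fun i => ?_) f
      · rwa [hf, sub_zero] at this
      · fin_cases i <;> simp
        · convert J1.neg_mem h2 using 1; simp [a01, b01]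
        · convert J1.neg_mem h1 using 1; simp [a10, b10]
  rw [h]
  exact RingHom.ker_isPrime _

lemma isPrime_J2 : J2.IsPrime := by
  have h : J2 = RingHom.ker (aeval ![X 0, 0, X 2, X 3, 0, X 5] : Param →ₐ[ℂ] Param) := by
    apply le_antisymm
    · rw [J2, Ideal.span_le]
      rintro f (rfl | rfl) <;> simp [RingHom.mem_ker, a01, b10]
    · intro f hf
      rw [RingHom.mem_ker] at hf
      have h1 : a01 ∈ J2 := Ideal.subset_span (by simp)
      have h2 : b10 ∈ J2 := Ideal.subset_span (by simp)
      have := sub_aeval_mem (J := J2) (v := ![X 0, 0, X 2, X 3, 0, X 5]) (fun i => ?_) f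
      · rwa [hf, sub_zero] at this
      · fin_cases i <;> simp
        · exact h1
        · exact h2
  rw [h]
  exact RingHom.ker_isPrime _

/-- The substitution `a₁₀ = -2 b₁₀`, `b₀₁ = -2 a₀₁`. -/
def substJ3 : Fin 6 → Param := ![-2 * X 4, X 1, X 2, X 3, X 4, -2 * X 1]

/-- The two linear generators eliminate `a10` and `b01`; what remains is the quadric, whose ideal is
a toric kernel. -/
lemma mem_J3_iff (f : Param) : f ∈ J3 ↔ toricMap expQuadric (aeval substJ3 f) = 0 := by
  have h1 : 2 * a01 + b01 ∈ J3 := Ideal.subset_span (by simp)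
  have h2 : a10 + 2 * b10 ∈ J3 := Ideal.subset_span (by simp)
  have h3 : a01 * b10 - am12 * b2m1 ∈ J3 := Ideal.subset_span (by simp)
  rw [← RingHom.mem_ker, ← quadricIdeal_eq_ker]
  have hsub : f - aeval substJ3 f ∈ J3 := by
    refine sub_aeval_mem (fun i => ?_) f
    fin_cases i <;> simp [substJ3]
    · exact h2
    · convert h1 using 1; simp [a01, b01]; ring
  refine ⟨fun hf => ?_, fun hf => ?_⟩
  · suffices J3 ≤ quadricIdeal.comap (aeval substJ3 : Param →ₐ[ℂ] Param) from this hf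
    rw [J3, Ideal.span_le]
    rintro f (rfl | rfl | rfl)
    · simp only [SetLike.mem_coe, Ideal.mem_comap, a01, b01, map_add, map_mul, map_ofNat, aeval_X]
      simp [substJ3]
    · simp only [SetLike.mem_coe, Ideal.mem_comap, a10, b10, map_add, map_mul, map_ofNat, aeval_X]
      simp [substJ3]
    · refine Ideal.subset_span ?_
      simp [substJ3, a01, b10, am12, b2m1]
  · have : quadricIdeal ≤ J3 := by
      rw [quadricIdeal, Ideal.span_singleton_le_iff_mem]
      exact h3
    have h4 := J3.add_mem hsub (this hf)
    rwa [sub_add_cancel] at h4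

lemma isPrime_J3 : J3.IsPrime := by
  have h : J3 = RingHom.ker ((toricMap expQuadric).comp (aeval substJ3)) := by
    ext f
    rw [mem_J3_iff, RingHom.mem_ker, AlgHom.comp_apply]
  rw [h]
  exact RingHom.ker_isPrime _

lemma isPrime_J4 : J4.IsPrime := by
  rw [J4_eq_ker]
  exact RingHom.ker_isPrime _

lemma isPrime_J (i : Fin 4) : (J i).IsPrime := by
  fin_cases i
  · exact isPrime_J1
  · exact isPrime_J2
  · exact isPrime_J3
  · exact isPrime_J4

end PrimeIdeals

/-! ### Sufficiency: the four center mechanisms. -/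

section Sufficiency

lemma pderiv_ofNat (i : Fin 2) (n : ℕ) [n.AtLeastTwo] :
    MvPowerSeries.pderiv ℂ i (ofNat(n) : MvPowerSeries (Fin 2) ℂ) = 0 := by
  rw [← map_ofNat MvPowerSeries.C, MvPowerSeries.pderiv_C]

lemma aeval_eq_zero_of_hamiltonian {g : ℕ → Param} (hg : IsFocusQuantities quadP quadQ g)
    {α : Fin 6 → ℂ} (h4 : α 4 = 2 * α 0) (h1 : α 1 = 2 * α 5) {k : ℕ} (hk : 1 ≤ k) :
    aeval α (g k) = 0 := by
  refine aeval_eq_zero_of_integratingFactor hg (V := 1) ?_ (by simp) hk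
  rw [← map_one MvPowerSeries.C, flow_C, divergence, h4, h1]
  simp

/-- A line `1 + u x + v y` is invariant, with cofactor `u x - v y`, exactly when `u² + a u = d v`
and `v² + b v = c u`. Generically there are three nonzero solutions, and the cubic is the product of
these lines written through symmetric functions, so it stays valid for all parameters. -/
lemma aeval_eq_zero_of_lotkaVolterra {g : ℕ → Param} (hg : IsFocusQuantities quadP quadQ g)
    {α : Fin 6 → ℂ} (h4 : α 4 = 0) (h1 : α 1 = 0) {k : ℕ} (hk : 1 ≤ k) :
    aeval α (g k) = 0 := by
  let x : MvPowerSeries (Fin 2) ℂ := MvPowerSeries.X 0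
  let y : MvPowerSeries (Fin 2) ℂ := MvPowerSeries.X 1
  let a : MvPowerSeries (Fin 2) ℂ := MvPowerSeries.C (α 0)
  let b : MvPowerSeries (Fin 2) ℂ := MvPowerSeries.C (α 5)
  let c : MvPowerSeries (Fin 2) ℂ := MvPowerSeries.C (α 2)
  let d : MvPowerSeries (Fin 2) ℂ := MvPowerSeries.C (α 3)
  refine aeval_eq_zero_of_integratingFactor hg (V := 1 - 2 * a * x - 2 * b * y
    + (a ^ 2 + b * d) * x ^ 2 + 3 * (a * b - c * d) * (x * y) + (b ^ 2 + a * c) * y ^ 2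
    - (a * b - c * d) * (d * x ^ 3 + a * (x ^ 2 * y) + b * (x * y ^ 2) + c * y ^ 3)) ?_
    (by simp [x, y]) hk
  rw [flow, divergence, fieldP, fieldQ, h4, h1]
  simp only [x, y, a, b, c, d, pow_succ, pow_zero, one_mul, map_add, map_sub,
    Derivation.leibniz, Derivation.map_one_eq_zero, pderiv_ofNat, MvPowerSeries.pderiv_C,
    MvPowerSeries.pderiv_X_self, smul_eq_mul,
    MvPowerSeries.pderiv_X_of_ne (show (1 : Fin 2) ≠ 0 by decide),
    MvPowerSeries.pderiv_X_of_ne (show (0 : Fin 2) ≠ 1 by decide), map_mul, map_ofNat, map_zero]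
  ring

/-- The conic `F` and the cubic `G` are invariant with cofactors `2 * L` and `3 * L`, and the
divergence is `5 * L`. So `F * G` is an inverse integrating factor, with constant term `2`. -/
lemma aeval_eq_zero_of_conic_cubic {g : ℕ → Param} (hg : IsFocusQuantities quadP quadQ g)
    (p q r s : ℂ) {k : ℕ} (hk : 1 ≤ k) :
    aeval ![-2 * (r * q * s), r * q * p, r ^ 2 * p, q ^ 2 * s, r * q * s, -2 * (r * q * p)]
      (g k) = 0 := by
  let x : MvPowerSeries (Fin 2) ℂ := MvPowerSeries.X 0
  let y : MvPowerSeries (Fin 2) ℂ := MvPowerSeries.X 1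
  let P : MvPowerSeries (Fin 2) ℂ := MvPowerSeries.C p
  let Q : MvPowerSeries (Fin 2) ℂ := MvPowerSeries.C q
  let R : MvPowerSeries (Fin 2) ℂ := MvPowerSeries.C r
  let S : MvPowerSeries (Fin 2) ℂ := MvPowerSeries.C s
  set α : Fin 6 → ℂ :=
    ![-2 * (r * q * s), r * q * p, r ^ 2 * p, q ^ 2 * s, r * q * s, -2 * (r * q * p)] with hα
  let L := R * Q * (S * x - P * y)
  let F := 1 + 2 * R * Q * (S * x + P * y) - R * Q ^ 3 * P * S * x ^ 2
    + 2 * R ^ 2 * Q ^ 2 * P * S * (x * y) - R ^ 3 * Q * P * S * y ^ 2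
  let e := R * S - Q * P
  let G := 2 + 6 * R * Q * (S * x + P * y) + 3 * R * Q ^ 2 * S * e * x ^ 2
    - 3 * R * Q * e ^ 2 * (x * y) - 3 * R ^ 2 * Q * P * e * y ^ 2
    - e * P * Q * R * S * (Q * x - R * y) ^ 3
  have hF : flow α F = 2 * L * F := by
    rw [flow, fieldP, fieldQ]
    simp only [hα, L, F, x, y, P, Q, R, S, pow_succ, pow_zero, one_mul, map_add, map_sub,
      Derivation.leibniz, Derivation.map_one_eq_zero, pderiv_ofNat, MvPowerSeries.pderiv_C,
      MvPowerSeries.pderiv_X_self, smul_eq_mul,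
      MvPowerSeries.pderiv_X_of_ne (show (1 : Fin 2) ≠ 0 by decide),
      MvPowerSeries.pderiv_X_of_ne (show (0 : Fin 2) ≠ 1 by decide), map_mul, map_ofNat, map_neg,
      Matrix.cons_val]
    ring
  have hG : flow α G = 3 * L * G := by
    rw [flow, fieldP, fieldQ]
    simp only [hα, L, G, e, x, y, P, Q, R, S, pow_succ, pow_zero, one_mul, map_add, map_sub,
      Derivation.leibniz, pderiv_ofNat, MvPowerSeries.pderiv_C,
      MvPowerSeries.pderiv_X_self, smul_eq_mul,
      MvPowerSeries.pderiv_X_of_ne (show (1 : Fin 2) ≠ 0 by decide),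
      MvPowerSeries.pderiv_X_of_ne (show (0 : Fin 2) ≠ 1 by decide), map_mul, map_ofNat, map_neg,
      Matrix.cons_val]
    ring
  refine aeval_eq_zero_of_integratingFactor hg (V := F * G) ?_ ?_ hk
  · have hd : divergence α = 5 * L := by
      simp only [divergence, hα, L, x, y, P, Q, R, S, Matrix.cons_val, map_sub, map_mul, map_neg,
        map_ofNat]
      ring
    rw [flow_mul, hF, hG, hd]
    ring
  · simp only [F, G, x, y, map_mul, map_add, map_sub, map_ofNat, map_pow]
    simp

/-- The coefficients of the image of a power series under the time-reversing involution. -/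
lemma recur_reverse {α : Fin 6 → ℂ} {c : ℂ} (hc : c ≠ 0) (h0 : α 0 = c * α 5)
    (h4 : α 4 = c * α 1) (h3 : α 3 = c ^ 3 * α 2) (w : ℤ → ℤ → ℂ) (i j : ℤ) :
    recur α (fun i j => c ^ (i - j) * w j i) i j = -(c ^ (i - j) * recur α w j i) := by
  have e1 : c ^ (i - 1 - j) = c ^ (i - j) * c⁻¹ := by
    rw [← zpow_sub_one₀ hc]; congr 1; ring
  have e2 : c ^ (i - (j - 1)) = c ^ (i - j) * c := by
    rw [← zpow_add_one₀ hc]; congr 1; ring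
  have e3 : c ^ (i + 1 - (j - 2)) = c ^ (i - j) * c ^ 3 := by
    rw [← zpow_natCast, ← zpow_add₀ hc]; congr 1; push_cast; ring
  have e4 : c ^ (i - 2 - (j + 1)) = c ^ (i - j) * (c ^ 3)⁻¹ := by
    rw [← zpow_natCast, ← zpow_neg, ← zpow_add₀ hc]; congr 1; push_cast; ring
  simp only [recur, e1, e2, e3, e4, h0, h3, h4]
  field_simp
  push_cast
  ring

lemma aeval_eq_zero_of_reversible {g : ℕ → Param} (hg : IsFocusQuantities quadP quadQ g)
    {α : Fin 6 → ℂ} {c : ℂ} (hc : c ≠ 0) (h0 : α 0 = c * α 5) (h4 : α 4 = c * α 1)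
    (h3 : α 3 = c ^ 3 * α 2) {k : ℕ} (hk : 1 ≤ k) : aeval α (g k) = 0 := by
  obtain ⟨F, -, hF⟩ := exists_specialization hg α
  -- This is `F(x, y) - F(y / c, c x)`. The involution reverses the field, so off-diagonal equations
  -- persist, the diagonal vanishes identically, and at `(k + 1, k + 1)` the focus quantity appears
  -- twice.
  set w : ℤ → ℤ → ℂ := fun i j => cf F i j - c ^ (i - j) * cf F j i with hw
  have hrec (i j : ℤ) : recur α w i j =
      recur α (cf F) i j + c ^ (i - j) * recur α (cf F) j i := by
    have h : recur α w i j = recur α (cf F) i j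
        - recur α (fun i j => c ^ (i - j) * cf F j i) i j := by
      simp only [recur, hw]; ring
    rw [h, recur_reverse hc h0 h4 h3, sub_neg_eq_add]
  have key := eq_zero_of_recur (α := α) (w := w) (N := 2 * k + 1)
    (fun i j hij => by
      simp only [hw, cf_of_neg hij, cf_of_neg (or_comm.mp hij), mul_zero, sub_zero])
    (fun i _ => by simp [hw]) (fun i j hi hj hne _ => by
      lift i to ℕ using hi
      lift j to ℕ using hj
      rw [hrec, hF, hF, if_neg (by omega), if_neg (by omega), mul_zero, add_zero])
  have h2 := recur_diag_eq_zero (α := α) (w := w) (m := k + 1) (fun i j hij => key i j (by omega))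
  have h5 := hF (k + 1) (k + 1)
  rw [if_pos (by omega)] at h5
  push_cast at h5
  rw [hrec, h5, sub_self, zpow_zero, one_mul, ← two_mul] at h2
  simpa using h2

lemma focusQuantity_mem_J3 {g : ℕ → Param} (hg : IsFocusQuantities quadP quadQ g) {k : ℕ}
    (hk : 1 ≤ k) : g k ∈ J3 := by
  rw [mem_J3_iff]
  refine MvPolynomial.funext fun z => ?_
  rw [← coe_aeval_eq_eval, RingHom.coe_coe, aeval_toricMap, map_zero, ← AlgHom.comp_apply,
    comp_aeval]
  convert aeval_eq_zero_of_conic_cubic hg (z 2) (z 1) (z 0) (z 3) hk using 2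
  congr 1
  funext i
  fin_cases i <;> simp [substJ3, expQuadric, Fin.prod_univ_six]

lemma focusQuantity_mem_J4 {g : ℕ → Param} (hg : IsFocusQuantities quadP quadQ g) {k : ℕ}
    (hk : 1 ≤ k) : g k ∈ J4 := by
  rw [J4_eq_ker, RingHom.mem_ker]
  -- The reversing ratio `c = z 0 / z 1` needs both coordinates nonzero; the extra factor covers the
  -- other points and is cancelled afterwards.
  have h : X 0 * X 1 * toricMap expJ4 (g k) = 0 := by
    refine MvPolynomial.funext fun z => ?_
    rw [← coe_aeval_eq_eval, RingHom.coe_coe, map_mul, map_mul, aeval_X, aeval_X, aeval_toricMap,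
      map_zero]
    by_cases hz : z 0 * z 1 = 0
    · rw [hz, zero_mul]
    obtain ⟨hz0, hz1⟩ := mul_ne_zero_iff.mp hz
    rw [aeval_eq_zero_of_reversible hg (c := z 0 / z 1) (div_ne_zero hz0 hz1) ?_ ?_ ?_ hk, mul_zero]
    all_goals
      simp [expJ4, Fin.prod_univ_five]
      field_simp
  simpa using h

lemma zeroLocus_subset_centerVariety {g : ℕ → Param} (hg : IsFocusQuantities quadP quadQ g)
    (i : Fin 4) : zeroLocus ℂ (J i) ⊆ centerVariety g := by
  intro α hα
  rw [centerVariety, focusIdeal, zeroLocus_span]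
  rintro _ ⟨k, hk, rfl⟩
  fin_cases i
  · have h1 := hα (2 * a10 - b10) (Ideal.subset_span (by simp))
    have h2 := hα (2 * b01 - a01) (Ideal.subset_span (by simp))
    simp only [a10, b10, a01, b01, map_sub, map_mul, map_ofNat, aeval_X] at h1 h2
    exact aeval_eq_zero_of_hamiltonian hg (by linear_combination -h1) (by linear_combination -h2) hk
  · have h1 := hα a01 (Ideal.subset_span (by simp))
    have h2 := hα b10 (Ideal.subset_span (by simp))
    simp only [b10, a01, aeval_X] at h1 h2
    exact aeval_eq_zero_of_lotkaVolterra hg h2 h1 hk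
  · exact hα _ (focusQuantity_mem_J3 hg hk)
  · exact hα _ (focusQuantity_mem_J4 hg hk)

end Sufficiency

/-! ### Necessity: explicit computation of the first three focus quantities. -/

section Necessity

set_option linter.unusedSimpArgs false in
/-- The vanishing of the first focus quantity. -/
lemma first_condition {α : Fin 6 → ℂ} {w : ℤ → ℤ → ℂ}
    (hneg : ∀ i j, i < 0 ∨ j < 0 → w i j = 0)
    (hlow : ∀ i j : ℤ, 0 ≤ i → 0 ≤ j → i + j ≤ 2 → w i j = if i = 1 ∧ j = 1 then 1 else 0)
    (hrec : ∀ i j : ℤ, 0 ≤ i → 0 ≤ j → recur α w i j = 0) :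
    α 0 * α 1 = α 5 * α 4 := by
  have v10 : w 1 0 = 0 := by rw [hlow _ _ (by norm_num) (by norm_num) (by norm_num)]; simp
  have v01 : w 0 1 = 0 := by rw [hlow _ _ (by norm_num) (by norm_num) (by norm_num)]; simp
  have v20 : w 2 0 = 0 := by rw [hlow _ _ (by norm_num) (by norm_num) (by norm_num)]; simp
  have v11 : w 1 1 = 1 := by rw [hlow _ _ (by norm_num) (by norm_num) (by norm_num)]; simp
  have v02 : w 0 2 = 0 := by rw [hlow _ _ (by norm_num) (by norm_num) (by norm_num)]; simp
  have v30 : w 3 0 = -α 3 / 3 := by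
    have h := hrec 3 0 (by norm_num) (by norm_num)
    simp only [recur, Int.reduceSub, Int.reduceAdd, Int.cast_ofNat,
      Int.cast_neg, Int.cast_one, Int.cast_zero, v20, hneg 3 (-1) (by norm_num), hneg 4 (-2) (by
      norm_num), v11] at h
    linear_combination (1/3) * h
  have v21 : w 2 1 = α 0 - α 4 := by
    have h := hrec 2 1 (by norm_num) (by norm_num)
    simp only [recur, Int.reduceSub, Int.reduceAdd, Int.cast_ofNat,
      Int.cast_neg, Int.cast_one, Int.cast_zero, v11, v20, hneg 3 (-1) (by norm_num), v02] at h
    linear_combination (1) * h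
  have v12 : w 1 2 = α 5 - α 1 := by
    have h := hrec 1 2 (by norm_num) (by norm_num)
    simp only [recur, Int.reduceSub, Int.reduceAdd, Int.cast_ofNat,
      Int.cast_neg, Int.cast_one, Int.cast_zero, v02, v11, v20, hneg (-1) 3 (by norm_num)] at h
    linear_combination (-1) * h
  have v03 : w 0 3 = -α 2 / 3 := by
    have h := hrec 0 3 (by norm_num) (by norm_num)
    simp only [recur, Int.reduceSub, Int.reduceAdd, Int.cast_ofNat,
      Int.cast_neg, Int.cast_one, Int.cast_zero, hneg (-1) 3 (by norm_num), v02, v11, hneg (-2) 4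
      (by norm_num)] at h
    linear_combination (-1/3) * h
  have h := hrec 2 2 (by norm_num) (by norm_num)
  simp only [recur, Int.reduceSub, Int.reduceAdd, Int.cast_ofNat,
    Int.cast_neg, Int.cast_one, Int.cast_zero, v12, v21, v30, v03] at h
  linear_combination -h

set_option linter.unusedSimpArgs false in
/-- The vanishing of the second and third focus quantities when the first one vanishes. -/
lemma second_third_conditions {α : Fin 6 → ℂ} {w : ℤ → ℤ → ℂ}
    (hneg : ∀ i j, i < 0 ∨ j < 0 → w i j = 0)
    (hlow : ∀ i j : ℤ, 0 ≤ i → 0 ≤ j → i + j ≤ 2 → w i j = if i = 1 ∧ j = 1 then 1 else 0)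
    (hrec : ∀ i j : ℤ, 0 ≤ i → 0 ≤ j → recur α w i j = 0)
    {s A B c d : ℂ} (h0 : α 0 = s * B) (h1 : α 1 = A) (h2 : α 2 = c) (h3 : α 3 = d)
    (h4 : α 4 = B) (h5 : α 5 = s * A) :
    (A ^ 3 * d - c * B ^ 3) * ((s + 2) * (2 * s - 1)) = 0 ∧
      (s = -2 → (A ^ 3 * d - c * B ^ 3) * (A * B - c * d) = 0) := by
  have v10 : w 1 0 = 0 := by rw [hlow _ _ (by norm_num) (by norm_num) (by norm_num)]; simp
  have v01 : w 0 1 = 0 := by rw [hlow _ _ (by norm_num) (by norm_num) (by norm_num)]; simp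
  have v20 : w 2 0 = 0 := by rw [hlow _ _ (by norm_num) (by norm_num) (by norm_num)]; simp
  have v11 : w 1 1 = 1 := by rw [hlow _ _ (by norm_num) (by norm_num) (by norm_num)]; simp
  have v02 : w 0 2 = 0 := by rw [hlow _ _ (by norm_num) (by norm_num) (by norm_num)]; simp
  have v30 : w 3 0 = -1 / 3 * d := by
    have h := hrec 3 0 (by norm_num) (by norm_num)
    simp only [recur, h0, h1, h2, h3, h4, h5, Int.reduceSub, Int.reduceAdd, Int.cast_ofNat,
      Int.cast_neg, Int.cast_one, Int.cast_zero, v20, hneg 3 (-1) (by norm_num), hneg 4 (-2) (by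
      norm_num), v11] at h
    linear_combination (1/3) * h
  have v21 : w 2 1 = s * B - B := by
    have h := hrec 2 1 (by norm_num) (by norm_num)
    simp only [recur, h0, h1, h2, h3, h4, h5, Int.reduceSub, Int.reduceAdd, Int.cast_ofNat,
      Int.cast_neg, Int.cast_one, Int.cast_zero, v11, v20, hneg 3 (-1) (by norm_num), v02] at h
    linear_combination (1) * h
  have v12 : w 1 2 = s * A - A := by
    have h := hrec 1 2 (by norm_num) (by norm_num)
    simp only [recur, h0, h1, h2, h3, h4, h5, Int.reduceSub, Int.reduceAdd, Int.cast_ofNat,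
      Int.cast_neg, Int.cast_one, Int.cast_zero, v02, v11, v20, hneg (-1) 3 (by norm_num)] at h
    linear_combination (-1) * h
  have v03 : w 0 3 = -1 / 3 * c := by
    have h := hrec 0 3 (by norm_num) (by norm_num)
    simp only [recur, h0, h1, h2, h3, h4, h5, Int.reduceSub, Int.reduceAdd, Int.cast_ofNat,
      Int.cast_neg, Int.cast_one, Int.cast_zero, hneg (-1) 3 (by norm_num), v02, v11, hneg (-2) 4
      (by norm_num)] at h
    linear_combination (-1/3) * h
  have v40 : w 4 0 = -1 / 2 * s * B * d + 1 / 4 * B * d := by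
    have h := hrec 4 0 (by norm_num) (by norm_num)
    simp only [recur, h0, h1, h2, h3, h4, h5, Int.reduceSub, Int.reduceAdd, Int.cast_ofNat,
      Int.cast_neg, Int.cast_one, Int.cast_zero, v30, hneg 4 (-1) (by norm_num), hneg 5 (-2) (by
      norm_num), v21] at h
    linear_combination (1/4) * h
  have v31 : w 3 1 = s ^ 2 * B ^ 2 - s * A * d - 3 / 2 * s * B ^ 2 + 1 / 2 * A * d + 1 / 2 * B ^ 2
    := by
    have h := hrec 3 1 (by norm_num) (by norm_num)
    simp only [recur, h0, h1, h2, h3, h4, h5, Int.reduceSub, Int.reduceAdd, Int.cast_ofNat,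
      Int.cast_neg, Int.cast_one, Int.cast_zero, v21, v30, hneg 4 (-1) (by norm_num), v12] at h
    linear_combination (1/2) * h
  have v13 : w 1 3 = s ^ 2 * A ^ 2 - 3 / 2 * s * A ^ 2 - s * B * c + 1 / 2 * A ^ 2 + 1 / 2 * B * c
    := by
    have h := hrec 1 3 (by norm_num) (by norm_num)
    simp only [recur, h0, h1, h2, h3, h4, h5, Int.reduceSub, Int.reduceAdd, Int.cast_ofNat,
      Int.cast_neg, Int.cast_one, Int.cast_zero, v03, v12, v21, hneg (-1) 4 (by norm_num)] at h
    linear_combination (-1/2) * h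
  have v04 : w 0 4 = -1 / 2 * s * A * c + 1 / 4 * A * c := by
    have h := hrec 0 4 (by norm_num) (by norm_num)
    simp only [recur, h0, h1, h2, h3, h4, h5, Int.reduceSub, Int.reduceAdd, Int.cast_ofNat,
      Int.cast_neg, Int.cast_one, Int.cast_zero, hneg (-1) 4 (by norm_num), v03, v12, hneg (-2) 5
      (by norm_num)] at h
    linear_combination (-1/4) * h
  have v50 : w 5 0 = -3 / 5 * s ^ 2 * B ^ 2 * d + 1 / 5 * s * A * d ^ 2 + 1 / 2 * s * B ^ 2 * d -
    1 / 10 * A * d ^ 2 - 1 / 10 * B ^ 2 * d := by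
    have h := hrec 5 0 (by norm_num) (by norm_num)
    simp only [recur, h0, h1, h2, h3, h4, h5, Int.reduceSub, Int.reduceAdd, Int.cast_ofNat,
      Int.cast_neg, Int.cast_one, Int.cast_zero, v40, hneg 5 (-1) (by norm_num), hneg 6 (-2) (by
      norm_num), v31] at h
    linear_combination (1/5) * h
  -- From here on the free resonant coefficient `w 2 2` is carried along; it must drop out of the
  -- final conditions.
  have v41 : w 4 1 = s ^ 3 * B ^ 3 - s ^ 2 * A * B * d - 11 / 6 * s ^ 2 * B ^ 3 + 1 / 6 * s * A *
    B * d + s * B ^ 3 + 1 / 6 * A * B * d - 1 / 6 * B ^ 3 - 2 / 3 * d * w 2 2 := by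
    have h := hrec 4 1 (by norm_num) (by norm_num)
    simp only [recur, h0, h1, h2, h3, h4, h5, Int.reduceSub, Int.reduceAdd, Int.cast_ofNat,
      Int.cast_neg, Int.cast_one, Int.cast_zero, v31, v40, hneg 5 (-1) (by norm_num)] at h
    linear_combination (1/3) * h
  have v32 : w 3 2 = -s ^ 3 * A * B ^ 2 - 2 * s ^ 2 * A ^ 2 * d + 9 / 2 * s ^ 2 * A * B ^ 2 + s *
    A ^ 2 * d - 5 * s * A * B ^ 2 + s * B * c * d + 2 * s * B * w 2 2 + 3 / 2 * A * B ^ 2 - 1 / 2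
    * B * c * d - 2 * B * w 2 2 := by
    have h := hrec 3 2 (by norm_num) (by norm_num)
    simp only [recur, h0, h1, h2, h3, h4, h5, Int.reduceSub, Int.reduceAdd, Int.cast_ofNat,
      Int.cast_neg, Int.cast_one, Int.cast_zero, v31, v40, v13] at h
    linear_combination (1) * h
  have v23 : w 2 3 = -s ^ 3 * A ^ 2 * B + 9 / 2 * s ^ 2 * A ^ 2 * B - 2 * s ^ 2 * B ^ 2 * c - 5 *
    s * A ^ 2 * B + s * A * c * d + 2 * s * A * w 2 2 + s * B ^ 2 * c + 3 / 2 * A ^ 2 * B - 1 / 2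
    * A * c * d - 2 * A * w 2 2 := by
    have h := hrec 2 3 (by norm_num) (by norm_num)
    simp only [recur, h0, h1, h2, h3, h4, h5, Int.reduceSub, Int.reduceAdd, Int.cast_ofNat,
      Int.cast_neg, Int.cast_one, Int.cast_zero, v13, v31, v04] at h
    linear_combination (-1) * h
  have v14 : w 1 4 = s ^ 3 * A ^ 3 - 11 / 6 * s ^ 2 * A ^ 3 - s ^ 2 * A * B * c + s * A ^ 3 + 1 /
    6 * s * A * B * c - 1 / 6 * A ^ 3 + 1 / 6 * A * B * c - 2 / 3 * c * w 2 2 := by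
    have h := hrec 1 4 (by norm_num) (by norm_num)
    simp only [recur, h0, h1, h2, h3, h4, h5, Int.reduceSub, Int.reduceAdd, Int.cast_ofNat,
      Int.cast_neg, Int.cast_one, Int.cast_zero, v04, v13, hneg (-1) 5 (by norm_num)] at h
    linear_combination (-1/3) * h
  have v05 : w 0 5 = -3 / 5 * s ^ 2 * A ^ 2 * c + 1 / 2 * s * A ^ 2 * c + 1 / 5 * s * B * c ^ 2 -
    1 / 10 * A ^ 2 * c - 1 / 10 * B * c ^ 2 := by
    have h := hrec 0 5 (by norm_num) (by norm_num)
    simp only [recur, h0, h1, h2, h3, h4, h5, Int.reduceSub, Int.reduceAdd, Int.cast_ofNat,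
      Int.cast_neg, Int.cast_one, Int.cast_zero, hneg (-1) 5 (by norm_num), v04, v13, hneg (-2) 6
      (by norm_num)] at h
    linear_combination (-1/5) * h
  refine ⟨?_, fun hs => ?_⟩
  -- The left side of this equation is one third of the claimed product.
  · have h := hrec 3 3 (by norm_num) (by norm_num)
    simp only [recur, h0, h1, h2, h3, h4, h5, Int.reduceSub, Int.reduceAdd, Int.cast_ofNat,
      Int.cast_neg, Int.cast_one, Int.cast_zero, v23, v32, v41, v14] at h
    linear_combination 3 * h
  · subst hs
    have v60 : w 6 0 = 55 / 36 * A * B * d ^ 2 + 35 / 4 * B ^ 3 * d + 1 / 9 * d ^ 2 * w 2 2 := by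
      have h := hrec 6 0 (by norm_num) (by norm_num)
      simp only [recur, h0, h1, h2, h3, h4, h5, Int.reduceSub, Int.reduceAdd, Int.cast_ofNat,
        Int.cast_neg, Int.cast_one, Int.cast_zero, v50, hneg 6 (-1) (by norm_num), hneg 7 (-2) (by
        norm_num), v41] at h
      linear_combination (1/6) * h
    have v51 : w 5 1 = 35 / 8 * A ^ 2 * d ^ 2 - 55 / 4 * A * B ^ 2 * d + 315 / 8 * B ^ 4 + 5 / 4 *
      B * c * d ^ 2 + 9 / 2 * B * d * w 2 2 := by
      have h := hrec 5 1 (by norm_num) (by norm_num)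
      simp only [recur, h0, h1, h2, h3, h4, h5, Int.reduceSub, Int.reduceAdd, Int.cast_ofNat,
        Int.cast_neg, Int.cast_one, Int.cast_zero, v41, v50, hneg 6 (-1) (by norm_num), v32] at h
      linear_combination (1/4) * h
    have v42 : w 4 2 = -115 / 4 * A ^ 2 * B * d - 405 / 2 * A * B ^ 3 + 5 / 2 * A * c * d ^ 2 + 7
      * A * d * w 2 2 + 65 / 4 * B ^ 2 * c * d + 24 * B ^ 2 * w 2 2 := by
      have h := hrec 4 2 (by norm_num) (by norm_num)
      simp only [recur, h0, h1, h2, h3, h4, h5, Int.reduceSub, Int.reduceAdd, Int.cast_ofNat,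
        Int.cast_neg, Int.cast_one, Int.cast_zero, v32, v41, v50, v23] at h
      linear_combination (1/2) * h
    have v24 : w 2 4 = -405 / 2 * A ^ 3 * B + 65 / 4 * A ^ 2 * c * d + 24 * A ^ 2 * w 2 2 - 115 /
      4 * A * B ^ 2 * c + 5 / 2 * B * c ^ 2 * d + 7 * B * c * w 2 2 := by
      have h := hrec 2 4 (by norm_num) (by norm_num)
      simp only [recur, h0, h1, h2, h3, h4, h5, Int.reduceSub, Int.reduceAdd, Int.cast_ofNat,
        Int.cast_neg, Int.cast_one, Int.cast_zero, v14, v23, v32, v05] at h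
      linear_combination (-1/2) * h
    have v15 : w 1 5 = 315 / 8 * A ^ 4 - 55 / 4 * A ^ 2 * B * c + 5 / 4 * A * c ^ 2 * d + 9 / 2 *
      A * c * w 2 2 + 35 / 8 * B ^ 2 * c ^ 2 := by
      have h := hrec 1 5 (by norm_num) (by norm_num)
      simp only [recur, h0, h1, h2, h3, h4, h5, Int.reduceSub, Int.reduceAdd, Int.cast_ofNat,
        Int.cast_neg, Int.cast_one, Int.cast_zero, v05, v14, v23, hneg (-1) 6 (by norm_num)] at h
      linear_combination (-1/4) * h
    have v06 : w 0 6 = 35 / 4 * A ^ 3 * c + 55 / 36 * A * B * c ^ 2 + 1 / 9 * c ^ 2 * w 2 2 := by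
      have h := hrec 0 6 (by norm_num) (by norm_num)
      simp only [recur, h0, h1, h2, h3, h4, h5, Int.reduceSub, Int.reduceAdd, Int.cast_ofNat,
        Int.cast_neg, Int.cast_one, Int.cast_zero, hneg (-1) 6 (by norm_num), v05, v14, hneg (-2)
        7 (by norm_num)] at h
      linear_combination (-1/6) * h
    have v70 : w 7 0 = -5 / 8 * A ^ 2 * d ^ 3 - 55 / 84 * A * B ^ 2 * d ^ 2 - 165 / 8 * B ^ 4 * d
      - 5 / 28 * B * c * d ^ 3 - 5 / 6 * B * d ^ 2 * w 2 2 := by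
      have h := hrec 7 0 (by norm_num) (by norm_num)
      simp only [recur, h0, h1, h2, h3, h4, h5, Int.reduceSub, Int.reduceAdd, Int.cast_ofNat,
        Int.cast_neg, Int.cast_one, Int.cast_zero, v60, hneg 7 (-1) (by norm_num), hneg 8 (-2) (by
        norm_num), v51] at h
      linear_combination (1/7) * h
    have v61 : w 6 1 = 89 / 24 * A ^ 2 * B * d ^ 2 + 487 / 4 * A * B ^ 3 * d - A * c * d ^ 3 - 8 /
      3 * A * d ^ 2 * w 2 2 - 693 / 8 * B ^ 5 - 37 / 4 * B ^ 2 * c * d ^ 2 - 39 / 2 * B ^ 2 * d *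
      w 2 2 := by
      have h := hrec 6 1 (by norm_num) (by norm_num)
      simp only [recur, h0, h1, h2, h3, h4, h5, Int.reduceSub, Int.reduceAdd, Int.cast_ofNat,
        Int.cast_neg, Int.cast_one, Int.cast_zero, v51, v60, hneg 7 (-1) (by norm_num), v42] at h
      linear_combination (1/5) * h
    have v52 : w 5 2 = 245 / 24 * A ^ 3 * d ^ 2 + 255 / 4 * A ^ 2 * B ^ 2 * d + 6135 / 8 * A * B ^
      4 - 85 / 36 * A * B * c * d ^ 2 - 77 / 6 * A * B * d * w 2 2 - 110 / 3 * B ^ 3 * c * d - 80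
      * B ^ 3 * w 2 2 + 2 / 9 * c * d ^ 2 * w 2 2 - d * w 3 3 := by
      have h := hrec 5 2 (by norm_num) (by norm_num)
      simp only [recur, h0, h1, h2, h3, h4, h5, Int.reduceSub, Int.reduceAdd, Int.cast_ofNat,
        Int.cast_neg, Int.cast_one, Int.cast_zero, v42, v51, v60] at h
      linear_combination (1/3) * h
    have v43 : w 4 3 = 580 * A ^ 3 * B * d - 1620 * A ^ 2 * B ^ 3 - 185 / 8 * A ^ 2 * c * d ^ 2 -
      40 * A ^ 2 * d * w 2 2 + 705 / 4 * A * B ^ 2 * c * d + 192 * A * B ^ 2 * w 2 2 + 1575 / 8 *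
      B ^ 4 * c - 15 / 4 * B * c ^ 2 * d ^ 2 - 11 / 2 * B * c * d * w 2 2 - 9 * B * w 3 3 := by
      have h := hrec 4 3 (by norm_num) (by norm_num)
      simp only [recur, h0, h1, h2, h3, h4, h5, Int.reduceSub, Int.reduceAdd, Int.cast_ofNat,
        Int.cast_neg, Int.cast_one, Int.cast_zero, v42, v51, v24] at h
      linear_combination (1) * h
    have v34 : w 3 4 = 1575 / 8 * A ^ 4 * d - 1620 * A ^ 3 * B ^ 2 + 705 / 4 * A ^ 2 * B * c * d +
      192 * A ^ 2 * B * w 2 2 + 580 * A * B ^ 3 * c - 15 / 4 * A * c ^ 2 * d ^ 2 - 11 / 2 * A * c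
      * d * w 2 2 - 9 * A * w 3 3 - 185 / 8 * B ^ 2 * c ^ 2 * d - 40 * B ^ 2 * c * w 2 2 := by
      have h := hrec 3 4 (by norm_num) (by norm_num)
      simp only [recur, h0, h1, h2, h3, h4, h5, Int.reduceSub, Int.reduceAdd, Int.cast_ofNat,
        Int.cast_neg, Int.cast_one, Int.cast_zero, v24, v42, v15] at h
      linear_combination (-1) * h
    have v25 : w 2 5 = 6135 / 8 * A ^ 4 * B - 110 / 3 * A ^ 3 * c * d - 80 * A ^ 3 * w 2 2 + 255 /
      4 * A ^ 2 * B ^ 2 * c - 85 / 36 * A * B * c ^ 2 * d - 77 / 6 * A * B * c * w 2 2 + 245 / 24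
      * B ^ 3 * c ^ 2 + 2 / 9 * c ^ 2 * d * w 2 2 - c * w 3 3 := by
      have h := hrec 2 5 (by norm_num) (by norm_num)
      simp only [recur, h0, h1, h2, h3, h4, h5, Int.reduceSub, Int.reduceAdd, Int.cast_ofNat,
        Int.cast_neg, Int.cast_one, Int.cast_zero, v15, v24, v06] at h
      linear_combination (-1/3) * h
    have v16 : w 1 6 = -693 / 8 * A ^ 5 + 487 / 4 * A ^ 3 * B * c - 37 / 4 * A ^ 2 * c ^ 2 * d -
      39 / 2 * A ^ 2 * c * w 2 2 + 89 / 24 * A * B ^ 2 * c ^ 2 - B * c ^ 3 * d - 8 / 3 * B * c ^ 2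
      * w 2 2 := by
      have h := hrec 1 6 (by norm_num) (by norm_num)
      simp only [recur, h0, h1, h2, h3, h4, h5, Int.reduceSub, Int.reduceAdd, Int.cast_ofNat,
        Int.cast_neg, Int.cast_one, Int.cast_zero, v06, v15, v24, hneg (-1) 7 (by norm_num)] at h
      linear_combination (-1/5) * h
    have v07 : w 0 7 = -165 / 8 * A ^ 4 * c - 55 / 84 * A ^ 2 * B * c ^ 2 - 5 / 28 * A * c ^ 3 * d
      - 5 / 6 * A * c ^ 2 * w 2 2 - 5 / 8 * B ^ 2 * c ^ 3 := by
      have h := hrec 0 7 (by norm_num) (by norm_num)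
      simp only [recur, h0, h1, h2, h3, h4, h5, Int.reduceSub, Int.reduceAdd, Int.cast_ofNat,
        Int.cast_neg, Int.cast_one, Int.cast_zero, hneg (-1) 7 (by norm_num), v06, v15, hneg (-2)
        8 (by norm_num)] at h
      linear_combination (-1/7) * h
    -- Both `w 2 2` and `w 3 3` cancel here, leaving `25 / 8` of the claimed product.
    have h := hrec 4 4 (by norm_num) (by norm_num)
    simp only [recur, h0, h1, h2, h3, h4, h5, Int.reduceSub, Int.reduceAdd, Int.cast_ofNat,
      Int.cast_neg, Int.cast_one, Int.cast_zero, v34, v43, v52, v25] at h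
    linear_combination (8 / 25) * h

end Necessity

/-! ### Decomposition of the center variety into the four zero loci. -/

section Decomposition

lemma mem_zeroLocus_J1 (α : Fin 6 → ℂ) :
    α ∈ zeroLocus ℂ J1 ↔ 2 * α 0 - α 4 = 0 ∧ 2 * α 5 - α 1 = 0 := by
  rw [J1, zeroLocus_span]
  simp [a10, b10, a01, b01]

lemma mem_zeroLocus_J2 (α : Fin 6 → ℂ) :
    α ∈ zeroLocus ℂ J2 ↔ α 1 = 0 ∧ α 4 = 0 := by
  rw [J2, zeroLocus_span]
  simp [b10, a01]

lemma mem_zeroLocus_J3 (α : Fin 6 → ℂ) :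
    α ∈ zeroLocus ℂ J3 ↔
      2 * α 1 + α 5 = 0 ∧ α 0 + 2 * α 4 = 0 ∧ α 1 * α 4 - α 2 * α 3 = 0 := by
  rw [J3, zeroLocus_span]
  simp [a10, b10, a01, b01, am12, b2m1]

lemma mem_zeroLocus_J4 (α : Fin 6 → ℂ) :
    α ∈ zeroLocus ℂ J4 ↔
      α 1 ^ 3 * α 3 - α 2 * α 4 ^ 3 = 0 ∧ α 0 * α 1 - α 5 * α 4 = 0 ∧
      α 0 ^ 3 * α 2 - α 3 * α 5 ^ 3 = 0 ∧ α 0 * α 2 * α 4 ^ 2 - α 1 ^ 2 * α 3 * α 5 = 0 ∧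
      α 0 ^ 2 * α 2 * α 4 - α 1 * α 3 * α 5 ^ 2 = 0 := by
  rw [J4, zeroLocus_span]
  simp [f1, f2, f3, f4, f5, a10, b10, a01, b01, am12, b2m1]

lemma mem_zeroLocus_span_f1_f2 (α : Fin 6 → ℂ) :
    α ∈ zeroLocus ℂ (Ideal.span {f1, f2}) ↔
      α 1 ^ 3 * α 3 - α 2 * α 4 ^ 3 = 0 ∧ α 0 * α 1 - α 5 * α 4 = 0 := by
  rw [zeroLocus_span]
  simp [f1, f2, a10, b10, a01, b01, am12, b2m1]

lemma mem_zeroLocus_J2_or_exists_ratio {α : Fin 6 → ℂ} (h : α 0 * α 1 = α 5 * α 4) :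
    α ∈ zeroLocus ℂ J2 ∨ ∃ s, α 0 = s * α 4 ∧ α 5 = s * α 1 := by
  rw [mem_zeroLocus_J2]
  by_cases h4 : α 4 = 0
  · by_cases h1 : α 1 = 0
    · exact Or.inl ⟨h1, h4⟩
    · refine Or.inr ⟨α 5 / α 1, ?_, by field_simp⟩
      rw [h4, mul_zero] at h ⊢
      exact (mul_eq_zero.mp h).resolve_right h1
  · refine Or.inr ⟨α 0 / α 4, by field_simp, ?_⟩
    field_simp
    exact h.symm

/-- Under proportionality `f2` vanishes and `f3`, `f4`, `f5` become multiples of `f1`. -/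
lemma mem_zeroLocus_J4_of_ratio {α : Fin 6 → ℂ} {s : ℂ} (h0 : α 0 = s * α 4)
    (h5 : α 5 = s * α 1) (h : α 1 ^ 3 * α 3 - α 2 * α 4 ^ 3 = 0) : α ∈ zeroLocus ℂ J4 := by
  rw [mem_zeroLocus_J4, h0, h5]
  refine ⟨h, by ring, ?_, ?_, ?_⟩
  · linear_combination -s ^ 3 * h
  · linear_combination -s * h
  · linear_combination -s ^ 2 * h

lemma zeroLocus_span_f1_f2 :
    (zeroLocus ℂ (Ideal.span {f1, f2}) : Set (Fin 6 → ℂ)) = zeroLocus ℂ J4 ∪ zeroLocus ℂ J2 := by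
  ext α
  rw [Set.mem_union, mem_zeroLocus_span_f1_f2]
  refine ⟨fun ⟨h1, h2⟩ => ?_, fun h => ?_⟩
  · rcases mem_zeroLocus_J2_or_exists_ratio (sub_eq_zero.mp h2) with h | ⟨s, h0, h5⟩
    · exact Or.inr h
    · exact Or.inl (mem_zeroLocus_J4_of_ratio h0 h5 h1)
  · rw [mem_zeroLocus_J4, mem_zeroLocus_J2] at h
    rcases h with h | ⟨h1, h4⟩
    · exact ⟨h.1, h.2.1⟩
    · simp [h1, h4]

lemma centerVariety_subset {g : ℕ → Param} (hg : IsFocusQuantities quadP quadQ g) :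
    centerVariety g ⊆ ⋃ i : Fin 4, zeroLocus ℂ (J i) := by
  intro α hα
  rw [centerVariety, focusIdeal, zeroLocus_span] at hα
  obtain ⟨F, hlow, hF⟩ := exists_specialization hg α
  have hneg : ∀ i j, i < 0 ∨ j < 0 → cf F i j = 0 := fun i j h => cf_of_neg h
  have hlow' : ∀ i j : ℤ, 0 ≤ i → 0 ≤ j → i + j ≤ 2 →
      cf F i j = if i = 1 ∧ j = 1 then 1 else 0 := fun i j hi hj hij => by
    lift i to ℕ using hi
    lift j to ℕ using hj
    rw [hlow i j (by omega)]
    exact if_congr (by omega) rfl rfl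
  have hrec : ∀ i j : ℤ, 0 ≤ i → 0 ≤ j → recur α (cf F) i j = 0 := fun i j hi hj => by
    lift i to ℕ using hi
    lift j to ℕ using hj
    rw [hF]
    split_ifs with h
    · exact hα _ ⟨i - 1, by omega, rfl⟩
    · rfl
  rw [Set.mem_iUnion]
  rcases mem_zeroLocus_J2_or_exists_ratio (first_condition hneg hlow' hrec) with h | ⟨s, h0, h5⟩
  · exact ⟨1, h⟩
  obtain ⟨c2, c3⟩ := second_third_conditions hneg hlow' hrec h0 rfl rfl rfl rfl h5
  rcases mul_eq_zero.mp c2 with hK | hs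
  · exact ⟨3, mem_zeroLocus_J4_of_ratio h0 h5 hK⟩
  rcases mul_eq_zero.mp hs with hs | hs
  · have hs' : s = -2 := by linear_combination hs
    rcases mul_eq_zero.mp (c3 hs') with hK | hq
    · exact ⟨3, mem_zeroLocus_J4_of_ratio h0 h5 hK⟩
    · refine ⟨2, (mem_zeroLocus_J3 α).mpr ⟨?_, ?_, hq⟩⟩
      · rw [h5, hs']; ring
      · rw [h0, hs']; ring
  · refine ⟨0, (mem_zeroLocus_J1 α).mpr ⟨?_, ?_⟩⟩
    · rw [h0]; linear_combination α 4 * hs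
    · rw [h5]; linear_combination α 1 * hs

theorem centerVariety_eq {g : ℕ → Param} (hg : IsFocusQuantities quadP quadQ g) :
    centerVariety g = ⋃ i : Fin 4, zeroLocus ℂ (J i) :=
  (centerVariety_subset hg).antisymm (Set.iUnion_subset (zeroLocus_subset_centerVariety hg))

/-- Each of the four varieties contains a point that lies on none of the others. -/
lemma exists_mem_zeroLocus_J_iff (i : Fin 4) :
    ∃ α : Fin 6 → ℂ, ∀ j, α ∈ zeroLocus ℂ (J j) ↔ j = i := by
  let pts : Fin 4 → Fin 6 → ℂ :=
    -- The second point satisfies `f1 = f2 = 0` and is kept off `V(J4)` by `f3`; the third lies on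
    -- the quadric but has `f1` nonzero.
    ![![1, 2, 0, 1, 2, 1], ![1, 0, 1, 1, 0, 0], ![-2, 1, 2, 1 / 2, 1, -2], ![1, 1, 1, 1, 1, 1]]
  refine ⟨pts i, fun j => ?_⟩
  have e (α : Fin 6 → ℂ) : (α ∈ zeroLocus ℂ (J 0) ↔ _) ∧ (α ∈ zeroLocus ℂ (J 1) ↔ _) ∧
      (α ∈ zeroLocus ℂ (J 2) ↔ _) ∧ (α ∈ zeroLocus ℂ (J 3) ↔ _) :=
    ⟨mem_zeroLocus_J1 α, mem_zeroLocus_J2 α, mem_zeroLocus_J3 α, mem_zeroLocus_J4 α⟩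
  obtain ⟨e0, e1, e2, e3⟩ := e (pts i)
  fin_cases j
  · refine e0.trans ?_
    fin_cases i <;> simp [pts] <;> norm_num
  · refine e1.trans ?_
    fin_cases i <;> simp [pts]
  · refine e2.trans ?_
    fin_cases i <;> (simp [pts]; try norm_num)
  · refine e3.trans ?_
    fin_cases i <;> (simp [pts]; try norm_num)

lemma eq_of_zeroLocus_J_subset {i j : Fin 4}
    (h : (zeroLocus ℂ (J i) : Set (Fin 6 → ℂ)) ⊆ zeroLocus ℂ (J j)) : i = j := by
  obtain ⟨α, hα⟩ := exists_mem_zeroLocus_J_iff i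
  exact ((hα j).mp (h ((hα i).mpr rfl))).symm

end Decomposition

/-! ### Irreducible varieties and components of finite unions. -/

section Irreducibility

variable {σ : Type*}

lemma IsAffineVariety.inter {V W : Set (σ → ℂ)} (hV : IsAffineVariety V)
    (hW : IsAffineVariety W) : IsAffineVariety (V ∩ W) := by
  obtain ⟨I, rfl⟩ := hV
  obtain ⟨K, rfl⟩ := hW
  exact ⟨I ⊔ K, (zeroLocus_vanishingIdeal_galoisConnection (k := ℂ) (K := ℂ)).l_sup.symm⟩

lemma IsAffineVariety.union {V W : Set (σ → ℂ)} (hV : IsAffineVariety V)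
    (hW : IsAffineVariety W) : IsAffineVariety (V ∪ W) := by
  obtain ⟨I, rfl⟩ := hV
  obtain ⟨K, rfl⟩ := hW
  refine ⟨I * K, Set.Subset.antisymm ?_ fun α hα => ?_⟩
  · exact Set.union_subset (zeroLocus_anti_mono Ideal.mul_le_left)
      (zeroLocus_anti_mono Ideal.mul_le_right)
  · by_contra h
    rw [Set.mem_union, not_or, mem_zeroLocus_iff, mem_zeroLocus_iff] at h
    push Not at h
    obtain ⟨⟨p, hp, hp0⟩, q, hq, hq0⟩ := h
    have h1 := hα (p * q) (Ideal.mul_mem_mul hp hq)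
    rw [map_mul] at h1
    exact mul_ne_zero hp0 hq0 h1

lemma isAffineVariety_empty : IsAffineVariety (∅ : Set (σ → ℂ)) :=
  ⟨⊤, zeroLocus_top.symm⟩

lemma isAffineVariety_biUnion {ι : Type*} {V : ι → Set (σ → ℂ)} (hV : ∀ i, IsAffineVariety (V i))
    (s : Finset ι) : IsAffineVariety (⋃ i ∈ s, V i) := by
  classical
  induction s using Finset.induction_on with
  | empty => simpa using isAffineVariety_empty
  | insert i s _ ih =>
    rw [Finset.set_biUnion_insert]
    exact (hV i).union ih

lemma IsIrreducibleVariety.exists_subset_of_subset_biUnion {ι : Type*} {W : Set (σ → ℂ)}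
    (hW : IsIrreducibleVariety W) {V : ι → Set (σ → ℂ)} (hV : ∀ i, IsAffineVariety (V i))
    (s : Finset ι) (h : W ⊆ ⋃ i ∈ s, V i) : ∃ i, W ⊆ V i := by
  classical
  induction s using Finset.induction_on with
  | empty =>
    obtain ⟨α, hα⟩ := hW.2.1
    simpa using h hα
  | insert i s _ ih =>
    rw [Finset.set_biUnion_insert] at h
    have e : W = W ∩ V i ∪ W ∩ ⋃ i ∈ s, V i := by
      rw [← Set.inter_union_distrib_left, Set.inter_eq_left.mpr h]
    rcases hW.2.2 _ _ (hW.1.inter (hV i)) (hW.1.inter (isAffineVariety_biUnion hV s)) e with h | h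
    · exact ⟨i, Set.inter_eq_left.mp h.symm⟩
    · exact ih (Set.inter_eq_left.mp h.symm)

/-- The irreducible components of an irredundant finite union of irreducible varieties. -/
lemma irreducibleComponentsOf_iUnion {ι : Type*} [Fintype ι] {V : ι → Set (σ → ℂ)}
    (hV : ∀ i, IsIrreducibleVariety (V i)) (hne : ∀ i j, V i ⊆ V j → i = j) :
    irreducibleComponentsOf (⋃ i, V i) = Set.range V := by
  have key : ∀ W, IsIrreducibleVariety W → W ⊆ ⋃ i, V i → ∃ i, W ⊆ V i := fun W hW h =>
    hW.exists_subset_of_subset_biUnion (fun i => (hV i).1) Finset.univ (by simpa using h)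
  ext W
  constructor
  · intro hW
    replace hW : Maximal (fun U => IsIrreducibleVariety U ∧ U ⊆ ⋃ i, V i) W := hW
    obtain ⟨i, hi⟩ := key W hW.prop.1 hW.prop.2
    exact ⟨i, (hW.eq_of_le ⟨hV i, Set.subset_iUnion V i⟩ hi).symm⟩
  · rintro ⟨i, rfl⟩
    refine ⟨⟨hV i, Set.subset_iUnion V i⟩, fun W hW hle => ?_⟩
    obtain ⟨j, hj⟩ := key W hW.1 hW.2
    rw [hne i j (hle.trans hj)]
    exact hj

lemma isIrreducibleVariety_zeroLocus [Finite σ] {P : Ideal (MvPolynomial σ ℂ)} (hP : P.IsPrime) :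
    IsIrreducibleVariety (zeroLocus ℂ P : Set (σ → ℂ)) := by
  -- By the Nullstellensatz a prime ideal is recovered from its zero locus; this gives nonemptiness
  -- and lets a product vanishing on the locus be placed in `P`.
  have hvan : vanishingIdeal ℂ (zeroLocus ℂ P : Set (σ → ℂ)) = P :=
    IsPrime.vanishingIdeal_zeroLocus P
  refine ⟨⟨P, rfl⟩, ?_, ?_⟩
  · rw [Set.nonempty_iff_ne_empty]
    intro h
    rw [h, vanishingIdeal_empty] at hvan
    exact hP.ne_top hvan.symm
  · rintro _ _ ⟨I, rfl⟩ ⟨K, rfl⟩ hIK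
    by_cases hI : I ≤ P
    · left
      exact (zeroLocus_anti_mono hI).antisymm (hIK ▸ Set.subset_union_left)
    by_cases hK : K ≤ P
    · right
      exact (zeroLocus_anti_mono hK).antisymm (hIK ▸ Set.subset_union_right)
    exfalso
    obtain ⟨p, hp, hpP⟩ := SetLike.not_le_iff_exists.mp hI
    obtain ⟨q, hq, hqP⟩ := SetLike.not_le_iff_exists.mp hK
    have hpq : p * q ∈ P := by
      rw [← hvan]
      intro α hα
      rw [hIK] at hα
      rw [map_mul]
      rcases hα with h | h
      · rw [h p hp, zero_mul]
      · rw [h q hq, mul_zero]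
    exact (hP.mem_or_mem hpq).elim hpP hqP

end Irreducibility

end

end CenterVariety

theorem mainTheorem8 :
    (∃ g : ℕ → CenterVariety.Param,
      CenterVariety.IsFocusQuantities CenterVariety.quadP CenterVariety.quadQ g) ∧
    (∀ g : ℕ → CenterVariety.Param,
      CenterVariety.IsFocusQuantities CenterVariety.quadP CenterVariety.quadQ g →
        CenterVariety.centerVariety g =
            ⋃ i : Fin 4, MvPolynomial.zeroLocus ℂ (CenterVariety.J i) ∧
        CenterVariety.irreducibleComponentsOf (CenterVariety.centerVariety g) =
            Set.range (fun i : Fin 4 => MvPolynomial.zeroLocus ℂ (CenterVariety.J i))) ∧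
    Function.Injective
      (fun i : Fin 4 =>
        (MvPolynomial.zeroLocus ℂ (CenterVariety.J i) : Set (Fin 6 → ℂ))) ∧
    (∀ i : Fin 4, (CenterVariety.J i).IsPrime) ∧
    MvPolynomial.zeroLocus ℂ (Ideal.span {CenterVariety.f1, CenterVariety.f2}) =
      (MvPolynomial.zeroLocus ℂ CenterVariety.J4 ∪
        MvPolynomial.zeroLocus ℂ CenterVariety.J2 : Set (Fin 6 → ℂ)) := by
  refine ⟨CenterVariety.exists_focusQuantities, fun g hg => ?_,
    fun i j hij => CenterVariety.eq_of_zeroLocus_J_subset hij.subset,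
    CenterVariety.isPrime_J, CenterVariety.zeroLocus_span_f1_f2⟩
  have h := CenterVariety.centerVariety_eq hg
  refine ⟨h, ?_⟩
  rw [h]
  exact CenterVariety.irreducibleComponentsOf_iUnion
    (fun i => CenterVariety.isIrreducibleVariety_zeroLocus (CenterVariety.isPrime_J i))
    fun i j hij => CenterVariety.eq_of_zeroLocus_J_subset hij
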